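/- Let $\epsilon_1,\epsilon_2\in[0,1]$. Consider the degraded wiretapped binary erasure channel $p_{YZ|X}=p_{Y|X}\,p_{Z|Y}$ from Alice (input $X\in\{0,1\}$) to Bob (output $Y\in\{0,1,e\}$) and Eve (output $Z\in\{0,1,e\}$): $Y$ equals $e$ with probability $\epsilon_1$ and $X$ otherwise; $Z=e$ if $Y=e$, and if $Y\neq e$ then $Z$ equals $e$ with probability $\epsilon_2$ and $Y$ otherwise; the uses of the channel are independent. For positive integers $n,m$, let $K_0,K_1\in\{0,1\}^m$ (Alice's strings) and $U\in\{0,1\}$ (Bob's choice bit) be independent and uniform. In an $(n,m)$-protocol Alice uses the channel $n$ times, and before each use and after the last one Alice and Bob send finitely many messages (over a countable alphabet) on a noiseless public channel that is heard by everybody. The order of channel uses and messages, including who sends each message, is fixed by the protocol; each channel input and each message is drawn, with local randomness, according to a distribution that depends on what its sender has generated and received so far. With $\mathbf F$ the public transcript, the final views are $V_A=(K_0,K_1,X^n,\mathbf F)$, $V_B=(U,Y^n,\mathbf F)$, $V_E=(Z^n,\mathbf F)$, and Bob outputs an estimate $\hat K_U$ of $K_U$ that is a function of $V_B$. All parties follow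 the protocol. Write $\overline U=1-U$. A rate $R$ is achievable if there is a sequence of $(n,m_n)$-protocols such that, as $n\to\infty$, $m_n/n\to R$ and $$P[\hat K_U\ne K_U]\to0,\quad I(K_{\overline U};V_B)\to0,\quad I(U;V_A)\to0,\quad I(K_0,K_1,U;V_E)\to0.$$ Let the oblivious transfer capacity $C$ be the supremum of the achievable rates, taken in $[0,\infty]$ (so $C=0$ if no rate is achievable). Then $$\min\left\{\tfrac13\,\epsilon_2(1-\epsilon_1),\ \epsilon_1\right\}\ \le\ C\ \le\ \min\left\{\epsilon_2(1-\epsilon_1),\ \epsilon_1\right\}.$$ In particular, $C=\epsilon_1$ whenever $\epsilon_1\le\frac13\epsilon_2(1-\epsilon_1)$. -/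

import Mathlib

open Filter Topology
open scoped ENNReal NNReal

noncomputable section

namespace WiretapOT

/-! ### Mutual information of discrete random variables -/

/-- The mutual information `I(A ; B)` (in nats) of two discrete random variables `A`, `B` on a
probability space with law `p`: the Kullback-Leibler divergence of the joint law from the product
of the marginal laws. -/
def mutualInfo {Ω α β : Type} (p : PMF Ω) (A : Ω → α) (B : Ω → β) : ℝ≥0∞ :=
  letI : MeasurableSpace α := ⊤
  letI : MeasurableSpace β := ⊤
  InformationTheory.klDiv
    (p.map (fun ω => (A ω, B ω))).toMeasure
    ((p.map A).toMeasure.prod (p.map B).toMeasure)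

/-! ### Channels -/

/-- The binary erasure channel with erasure probability `ε`; `none` is the erasure symbol. -/
def bec (ε : unitInterval) (x : Bool) : PMF (Option Bool) :=
  PMF.ofFintype
    (fun y => if y = none then ENNReal.ofReal ε
      else if y = some x then ENNReal.ofReal (1 - ε) else 0)
    (by
      have h : ENNReal.ofReal (ε : ℝ) + ENNReal.ofReal (1 - ε) = 1 := by
        rw [← ENNReal.ofReal_add ε.2.1 (by linarith [ε.2.2])]
        simp
      cases x <;> simpa [Fintype.sum_option] using h)

/-- The second stage of the cascade: an erased symbol stays erased, an unerased bit is sent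
through a binary erasure channel with erasure probability `ε`. -/
def becStage (ε : unitInterval) : Option Bool → PMF (Option Bool)
  | none => PMF.pure none
  | some b => bec ε b

/-- The degraded wiretapped erasure channel `p(y, z | x) = p(y | x) p(z | y)`: Bob's output `y` is
obtained from `x` by a BEC with erasure probability `ε₁`, and Eve's output `z` from `y` by a BEC
with erasure probability `ε₂`. -/
def degradedBEC (ε₁ ε₂ : unitInterval) (x : Bool) : PMF (Option Bool × Option Bool) :=
  (bec ε₁ x).bind fun y => (becStage ε₂ y).map fun z => (y, z)

/-! ### Protocols -/

/-- One elementary step of a protocol: a public message by Alice, a public message by Bob, or one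
use of the broadcast channel by Alice. -/
inductive Step
  | aliceMessage
  | bobMessage
  | channelUse
  deriving DecidableEq

/-- Alice's private data: `K false` is the string `K₀` and `K true` is the string `K₁`. -/
abbrev Strings (m : ℕ) : Type := Bool → Fin m → Bool

/-- An `(n, m)`-protocol over a broadcast channel with input alphabet `{0, 1}`, where `Y` is the
output alphabet of Bob.

The protocol fixes a finite sequence of steps with exactly `n` channel uses, and any finite number
of public messages by Alice and by Bob before each channel use and after the last one. Every message
and every channel input is drawn, with fresh local randomness, from a distribution determined by
what its sender has generated and received so far: for Alice her strings, the past channel inputs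
and the public transcript; for Bob his choice bit, the past channel outputs and the public
transcript. All lists have the most recent entry first. -/
structure Protocol (Y : Type) (n m : ℕ) where
  /-- The alphabet of public messages. -/
  Msg : Type
  countable_msg : Countable Msg
  /-- The order of the steps. -/
  schedule : List Step
  count_channelUse : schedule.count Step.channelUse = n
  /-- The law of Alice's next public message. -/
  aliceMsg : Strings m → List Bool → List Msg → PMF Msg
  /-- The law of Bob's next public message. -/
  bobMsg : Bool → List Y → List Msg → PMF Msg
  /-- The law of Alice's next channel input. -/
  input : Strings m → List Bool → List Msg → PMF Bool
  /-- Bob's estimate of the chosen string, a function of his final view. -/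
  estimate : Bool → List Y → List Msg → Fin m → Bool

/-- The random variables of a protocol execution: Alice's strings `K`, Bob's choice bit `U`,
the channel inputs `X`, the channel outputs `Y` at Bob and `Z` at Eve, and the public
transcript `F`. -/
structure Execution (Msg Y Z : Type) (m : ℕ) where
  strings : Strings m
  choice : Bool
  xs : List Bool
  ys : List Y
  zs : List Z
  transcript : List Msg

namespace Execution

variable {Msg Y Z : Type} {m : ℕ}

/-- Alice's view `(K₀, K₁, X, F)`. -/
def viewA (ω : Execution Msg Y Z m) : Strings m × List Bool × List Msg :=
  (ω.strings, ω.xs, ω.transcript)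

/-- Bob's view `(U, Y, F)`. -/
def viewB (ω : Execution Msg Y Z m) : Bool × List Y × List Msg :=
  (ω.choice, ω.ys, ω.transcript)

/-- Eve's view `(Z, F)`. -/
def viewE (ω : Execution Msg Y Z m) : List Z × List Msg :=
  (ω.zs, ω.transcript)

/-- The string `K_U` that Bob has chosen. -/
def chosen (ω : Execution Msg Y Z m) : Fin m → Bool := ω.strings ω.choice

/-- The string that Bob has not chosen. -/
def unchosen (ω : Execution Msg Y Z m) : Fin m → Bool := ω.strings (!ω.choice)

/-- All private data `(K₀, K₁, U)`. -/
def secrets (ω : Execution Msg Y Z m) : Strings m × Bool := (ω.strings, ω.choice)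

end Execution

namespace Protocol

variable {Y Z : Type} {n m : ℕ}

/-- One step of the execution of `P` over the memoryless broadcast channel `W`. -/
def step (P : Protocol Y n m) (W : Bool → PMF (Y × Z)) (ω : Execution P.Msg Y Z m) :
    Step → PMF (Execution P.Msg Y Z m)
  | .aliceMessage =>
      (P.aliceMsg ω.strings ω.xs ω.transcript).map
        fun f => { ω with transcript := f :: ω.transcript }
  | .bobMessage =>
      (P.bobMsg ω.choice ω.ys ω.transcript).map
        fun f => { ω with transcript := f :: ω.transcript }
  | .channelUse =>
      (P.input ω.strings ω.xs ω.transcript).bind fun x =>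
        (W x).map fun yz =>
          { ω with xs := x :: ω.xs, ys := yz.1 :: ω.ys, zs := yz.2 :: ω.zs }

/-- The law of the execution after a given list of steps has been carried out. -/
def run (P : Protocol Y n m) (W : Bool → PMF (Y × Z)) :
    List Step → Execution P.Msg Y Z m → PMF (Execution P.Msg Y Z m)
  | [], ω => PMF.pure ω
  | s :: l, ω => (P.step W ω s).bind (P.run W l)

/-- The joint law of all random variables at the end of the protocol, when `K₀`, `K₁`, `U` are
independent and uniform. -/
def law (P : Protocol Y n m) (W : Bool → PMF (Y × Z)) : PMF (Execution P.Msg Y Z m) :=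
  (PMF.uniformOfFintype (Strings m × Bool)).bind fun d =>
    P.run W P.schedule ⟨d.1, d.2, [], [], [], []⟩

/-- The probability that Bob's estimate differs from `K_U`. -/
def errorProb (P : Protocol Y n m) (W : Bool → PMF (Y × Z)) : ℝ≥0∞ :=
  (P.law W).toOuterMeasure {ω | P.estimate ω.choice ω.ys ω.transcript ≠ ω.chosen}

/-- What Bob learns about the string he has not chosen. -/
def leakToBob (P : Protocol Y n m) (W : Bool → PMF (Y × Z)) : ℝ≥0∞ :=
  mutualInfo (P.law W) Execution.unchosen Execution.viewB

/-- What Alice learns about Bob's choice bit. -/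
def leakToAlice (P : Protocol Y n m) (W : Bool → PMF (Y × Z)) : ℝ≥0∞ :=
  mutualInfo (P.law W) Execution.choice Execution.viewA

/-- What Eve learns about the private data of Alice and Bob. -/
def leakToEve (P : Protocol Y n m) (W : Bool → PMF (Y × Z)) : ℝ≥0∞ :=
  mutualInfo (P.law W) Execution.secrets Execution.viewE

end Protocol

/-! ### Oblivious transfer capacity -/

/-- The rate `R` is achievable for oblivious transfer over the broadcast channel `W`, with
honest-but-curious users and eavesdropper: some sequence of `(n, m n)`-protocols has rates
`m n / n → R`, vanishing error probability and vanishing leakage to Bob, Alice and Eve. -/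
def Achievable {Y Z : Type} (W : Bool → PMF (Y × Z)) (R : ℝ≥0) : Prop :=
  ∃ (m : ℕ → ℕ) (P : ∀ n, Protocol Y n (m n)),
    (∀ n, 0 < m n) ∧
    Tendsto (fun n => (m n : ℝ≥0) / (n : ℝ≥0)) atTop (𝓝 R) ∧
    Tendsto (fun n => (P n).errorProb W) atTop (𝓝 0) ∧
    Tendsto (fun n => (P n).leakToBob W) atTop (𝓝 0) ∧
    Tendsto (fun n => (P n).leakToAlice W) atTop (𝓝 0) ∧
    Tendsto (fun n => (P n).leakToEve W) atTop (𝓝 0)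

/-- The oblivious transfer capacity of `W`: the supremum, in `[0, ∞]`, of the achievable rates. -/
def otCapacity {Y Z : Type} (W : Bool → PMF (Y × Z)) : ℝ≥0∞ :=
  ⨆ (R : ℝ≥0) (_ : Achievable W R), (R : ℝ≥0∞)

end WiretapOT

end

noncomputable section

namespace WiretapOT

/-! ### Information measures -/

section Information

open MeasureTheory InformationTheory

/-! Everything rests on the factorisation `Protocol.law_apply`: the probability of an execution is a
factor of Alice (strings, inputs, transcript) times a channel factor times a factor of Bob (choice,
outputs, transcript). In the converses, small mutual information enters only through a weak Pinsker
inequality, `toOuterMeasure_le_add_mutualInfo`, so both arguments bound probabilities of events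
instead of entropies.

Upper bound `ε₁` (`Protocol.half_le_of_erasures`). When `U = 1`, Bob recovers `K₁`. Given `(X, F)`,
the strings are independent of `(U, Y, Z)`, so the best guess of `K₁` from `(X, F)` is at least as
good as Bob's estimate. Whether this guess is correct is visible in Alice's view, which hardly
depends on `U`, so the guess succeeds nearly as often when `U = 0`. But then `K₁` is the unchosen
string, and Bob, who knows `X` up to its erased bits, can list `2 ^ (number of erasures)` candidates
for it. If `m` exceeds the number of erasures linearly in `n`, this contradicts the secrecy of the
unchosen string.

Upper bound `ε₂ (1 - ε₁)` (`Protocol.one_le_of_secret`). In `scrambledBEC` each bit received by Bob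
but not by Eve is replaced by a fresh coin, so given Eve's view and `U`, Bob's estimate is
independent of the strings. Replacing the channel costs a factor 2 for each such position, and
secrecy against Eve makes the chosen string nearly uniform given her view. Hence Bob succeeds with
small probability if `m` exceeds the number of these positions linearly. `exists_tail_bound`
controls both counts, also for inputs chosen adaptively.

Lower bound (`achievable_of_lt`). Alice sends uniform bits. Bob announces `m` positions that he
received, `m` erased ones, and `s` further received ones. A random linear hash of the last block
gives `2 m + 1` key bits: one hides which block belongs to which string, the others pad both strings
against Eve. The pads are needed because Eve sees part of the good block, and the order must be
hidden because her erasures distinguish the blocks. Each privacy claim comes from an involution of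
the sample space that preserves the law and the view while changing the secret
(`map_apply_le_of_injective`). Leakage to Alice and Bob is exactly zero; leakage to Eve is paid only
when the hash is not surjective on the key bits erased for her. The requirements are `R < ε₁`, `σ ε₂
> 2 R` and `R + σ < 1 - ε₁` for a key block of rate `σ`. The last two are compatible when `R (1 + 2
/ ε₂) < 1 - ε₁`, and since `ε₂ ≤ 1` it suffices that `3 R < ε₂ (1 - ε₁)`. -/

lemma mul_le_klFun_add {r : ℝ} (hr : 0 ≤ r) (δ : ℝ) :
    δ * r ≤ klFun r + (Real.exp δ - 1) := by
  rw [klFun_apply]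
  rcases hr.eq_or_lt with rfl | h
  · simp [Real.exp_nonneg]
  · have h1 := Real.log_le_sub_one_of_pos (div_pos (Real.exp_pos δ) h)
    rw [Real.log_div (Real.exp_pos δ).ne' h.ne', Real.log_exp] at h1
    have h2 := mul_le_mul_of_nonneg_left h1 hr
    have h3 : r * (Real.exp δ / r - 1) = Real.exp δ - r := by field_simp
    nlinarith

lemma exp_sub_one_le {δ : ℝ} (h0 : 0 ≤ δ) (h1 : δ ≤ 1) : Real.exp δ - 1 ≤ δ + δ ^ 2 := by
  have := Real.abs_exp_sub_one_sub_id_le (x := δ) (by rwa [abs_of_nonneg h0])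
  linarith [(abs_le.1 this).2]

/-- A weak form of Pinsker's inequality. -/
lemma measure_le_add_klDiv {α : Type*} [MeasurableSpace α] (μ ν : Measure α)
    [IsProbabilityMeasure μ] [IsProbabilityMeasure ν] (S : Set α)
    {δ : ℝ} (h0 : 0 < δ) (h1 : δ ≤ 1) :
    μ S ≤ ν S + (ENNReal.ofReal δ + klDiv μ ν / ENNReal.ofReal δ) := by
  have hδ0 : ENNReal.ofReal δ ≠ 0 := by simpa using h0
  by_cases htop : klDiv μ ν = ∞
  · rw [htop, ENNReal.top_div_of_ne_top ENNReal.ofReal_ne_top]; simp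
  have hac : μ ≪ ν := (klDiv_ne_top_iff.1 htop).1
  -- Fenchel–Young applied to the density and integrated over `S`; after division by `δ`, the second
  -- term is `(1 + δ) ν S ≤ ν S + δ`.
  have key : ENNReal.ofReal δ * μ S ≤ klDiv μ ν + ENNReal.ofReal (δ + δ ^ 2) * ν S := by
    rw [klDiv_eq_lintegral_klFun_of_ac hac, ← Measure.setLIntegral_rnDeriv hac S,
      ← lintegral_const_mul _ (Measure.measurable_rnDeriv μ ν)]
    calc ∫⁻ x in S, ENNReal.ofReal δ * μ.rnDeriv ν x ∂ν
        ≤ ∫⁻ x in S, (ENNReal.ofReal (klFun (μ.rnDeriv ν x).toReal)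
            + ENNReal.ofReal (δ + δ ^ 2)) ∂ν := by
          refine lintegral_mono_ae (ae_restrict_of_ae ?_)
          filter_upwards [Measure.rnDeriv_lt_top μ ν] with x hx
          have h2 := mul_le_klFun_add (ENNReal.toReal_nonneg (a := μ.rnDeriv ν x)) δ
          rw [← ENNReal.ofReal_add (klFun_nonneg ENNReal.toReal_nonneg) (by positivity)]
          nth_rw 1 [← ENNReal.ofReal_toReal hx.ne]
          rw [← ENNReal.ofReal_mul h0.le]
          exact ENNReal.ofReal_le_ofReal (by linarith [exp_sub_one_le h0.le h1])
      _ = (∫⁻ x in S, ENNReal.ofReal (klFun (μ.rnDeriv ν x).toReal) ∂ν)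
            + ENNReal.ofReal (δ + δ ^ 2) * ν S := by
          rw [lintegral_add_right _ measurable_const, setLIntegral_const]
      _ ≤ _ := add_le_add_left (setLIntegral_le_lintegral _ _) _
  have h3 : μ S = ENNReal.ofReal δ * μ S / ENNReal.ofReal δ := by
    rw [mul_comm, ENNReal.mul_div_cancel_right hδ0 ENNReal.ofReal_ne_top]
  rw [h3]
  refine (ENNReal.div_le_div_right key _).trans ?_
  rw [ENNReal.add_div, show δ + δ ^ 2 = δ * (1 + δ) by ring, ENNReal.ofReal_mul h0.le, mul_assoc,
    mul_comm (ENNReal.ofReal δ) (_ * ν S), ENNReal.mul_div_cancel_right hδ0 ENNReal.ofReal_ne_top,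
    ENNReal.ofReal_add zero_le_one h0.le, add_mul, ENNReal.ofReal_one, one_mul, add_comm, add_assoc]
  gcongr
  exact mul_le_of_le_one_right' prob_le_one

variable {Ω α β : Type}

lemma prod_toMeasure_apply [Countable α] [Countable β] (p : PMF α) (q : PMF β) (S : Set (α × β)) :
    letI : MeasurableSpace α := ⊤
    letI : MeasurableSpace β := ⊤
    (p.toMeasure.prod q.toMeasure) S = ∑' x : α × β, S.indicator (fun x => p x.1 * q x.2) x := by
  let _ : MeasurableSpace α := ⊤
  let _ : MeasurableSpace β := ⊤
  have : DiscreteMeasurableSpace α := ⟨fun _ => trivial⟩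
  have : DiscreteMeasurableSpace β := ⟨fun _ => trivial⟩
  change (p.toMeasure.prod q.toMeasure) S = _
  rw [← Measure.tsum_indicator_apply_singleton _ S (.of_discrete)]
  refine tsum_congr fun x => ?_
  by_cases hx : x ∈ S
  · rw [Set.indicator_of_mem hx, Set.indicator_of_mem hx]
    have : ({x} : Set (α × β)) = {x.1} ×ˢ {x.2} := by ext ⟨a, b⟩; simp [Prod.ext_iff]
    rw [this, Measure.prod_prod, PMF.toMeasure_apply_singleton _ _ (.of_discrete),
      PMF.toMeasure_apply_singleton _ _ (.of_discrete)]
  · rw [Set.indicator_of_notMem hx, Set.indicator_of_notMem hx]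

/-- An event about a pair `(A, B)` is about as likely as if `A` and `B` were independent, when
their mutual information is small. -/
lemma toOuterMeasure_le_add_mutualInfo [Countable α] [Countable β] (p : PMF Ω) (A : Ω → α)
    (B : Ω → β) (S : Set (α × β)) {δ : ℝ} (h0 : 0 < δ) (h1 : δ ≤ 1) :
    p.toOuterMeasure {ω | (A ω, B ω) ∈ S} ≤
      (∑' x : α × β, S.indicator (fun x => p.map A x.1 * p.map B x.2) x)
        + (ENNReal.ofReal δ + mutualInfo p A B / ENNReal.ofReal δ) := by
  let _ : MeasurableSpace α := ⊤
  let _ : MeasurableSpace β := ⊤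
  have : DiscreteMeasurableSpace α := ⟨fun _ => trivial⟩
  have : DiscreteMeasurableSpace β := ⟨fun _ => trivial⟩
  have h := measure_le_add_klDiv (p.map (fun ω => (A ω, B ω))).toMeasure
    ((p.map A).toMeasure.prod (p.map B).toMeasure) S h0 h1
  rw [prod_toMeasure_apply, PMF.toMeasure_apply_eq_toOuterMeasure_apply _ (.of_discrete),
    PMF.toOuterMeasure_map_apply] at h
  exact h

lemma klFun_le {r c : ℝ} (hr : 0 ≤ r) (hrc : r ≤ c) :
    klFun r ≤ r * Real.log c + 1 := by
  rw [klFun_apply]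
  rcases hr.eq_or_lt with rfl | h
  · simp
  · have := mul_le_mul_of_nonneg_left (Real.log_le_log h hrc) hr
    linarith

lemma tsum_map_fst_pair (p : PMF Ω) (A : Ω → α) (B : Ω → β) (b : β) :
    ∑' a, p.map (fun ω => (A ω, B ω)) (a, b) = p.map B b := by
  classical
  simp only [PMF.map_apply, Prod.mk.injEq]
  rw [ENNReal.tsum_comm]
  refine tsum_congr fun ω => ?_
  rw [tsum_eq_single (A ω)]
  · simp
  · intro a ha; simp [ha]

/-- If `A` is uniform and its posterior law given `B = b` is uniform for all `b` in `G`, then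
`I(A ; B)` is controlled by the probability that `B ∉ G`. -/
lemma mutualInfo_le_of_uniform [Fintype α] [Nonempty α] [Countable β] (p : PMF Ω) (A : Ω → α)
    (B : Ω → β) (G : Set β) (hA : ∀ a, p.map A a = (Fintype.card α : ℝ≥0∞)⁻¹)
    (hG : ∀ b ∈ G, ∀ a a', p.map (fun ω => (A ω, B ω)) (a, b) ≤
      p.map (fun ω => (A ω, B ω)) (a', b)) :
    mutualInfo p A B ≤ p.toOuterMeasure {ω | B ω ∉ G}
      * ENNReal.ofReal (Real.log (Fintype.card α) + 1) := by
  classical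
  let _ : MeasurableSpace α := ⊤
  let _ : MeasurableSpace β := ⊤
  have : DiscreteMeasurableSpace α := ⟨fun _ => trivial⟩
  have : DiscreteMeasurableSpace β := ⟨fun _ => trivial⟩
  set μ := (p.map (fun ω => (A ω, B ω))).toMeasure with hμ
  set ν := (p.map A).toMeasure.prod (p.map B).toMeasure with hν
  change klDiv μ ν ≤ _
  set c : ℝ≥0∞ := (Fintype.card α : ℝ≥0∞) with hc
  have hc0 : c ≠ 0 := by simp [hc]
  have hct : c ≠ ∞ := by simp [hc]
  -- The density of the joint law with respect to the product law, as `A` is uniform. It is at most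
  -- `|α|` everywhere and equals 1 over `G`, where `klFun` vanishes, so only the complement of `G`
  -- contributes to the divergence.
  set r : α × β → ℝ≥0∞ := fun x => c * p.map (fun ω => (A ω, B ω)) x / p.map B x.2 with hr
  have hle : ∀ x : α × β, p.map (fun ω => (A ω, B ω)) x ≤ p.map B x.2 := by
    rintro ⟨a, b⟩
    rw [← tsum_map_fst_pair p A B b]
    exact ENNReal.le_tsum a
  have hB0 : ∀ x : α × β, p.map B x.2 = 0 → p.map (fun ω => (A ω, B ω)) x = 0 := fun x h =>
    le_antisymm (h ▸ hle x) bot_le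
  have hν1 : ∀ x : α × β, ν {x} = c⁻¹ * p.map B x.2 := by
    intro x
    have : ({x} : Set (α × β)) = {x.1} ×ˢ {x.2} := by ext ⟨a, b⟩; simp [Prod.ext_iff]
    rw [this, hν, Measure.prod_prod, PMF.toMeasure_apply_singleton _ _ (.of_discrete),
      PMF.toMeasure_apply_singleton _ _ (.of_discrete), hA]
  have hμν : μ = ν.withDensity r := by
    refine Measure.ext_of_singleton fun x => ?_
    rw [withDensity_apply _ (.of_discrete), lintegral_singleton, hν1,
      hμ, PMF.toMeasure_apply_singleton _ _ (.of_discrete)]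
    by_cases hb : p.map B x.2 = 0
    · rw [hB0 x hb, hb]; simp
    · rw [hr]
      rw [show c * p.map (fun ω => (A ω, B ω)) x / p.map B x.2 * (c⁻¹ * p.map B x.2)
        = (c * c⁻¹) * (p.map (fun ω => (A ω, B ω)) x * (p.map B x.2 / p.map B x.2)) by
        rw [div_eq_mul_inv, div_eq_mul_inv]; ring]
      rw [ENNReal.mul_inv_cancel hc0 hct, ENNReal.div_self hb (PMF.apply_ne_top _ _)]; simp
  have hrm : Measurable r := .of_discrete
  have hac : μ ≪ ν := hμν ▸ withDensity_absolutelyContinuous _ _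
  have hrc : ∀ x, r x ≤ c := by
    intro x
    rw [hr]
    refine ENNReal.div_le_of_le_mul ?_
    gcongr
    exact hle x
  have hrG : ∀ x : α × β, x.2 ∈ G → p.map B x.2 ≠ 0 → r x = 1 := by
    rintro ⟨a, b⟩ hb hb0
    have heq : c * p.map (fun ω => (A ω, B ω)) (a, b) = p.map B b := by
      rw [← tsum_map_fst_pair p A B b, tsum_fintype,
        Finset.sum_congr rfl (fun a' _ => le_antisymm (hG b hb a' a) (hG b hb a a'))]
      simp [hc]
    rw [hr]
    dsimp only
    rw [heq, ENNReal.div_self hb0 (PMF.apply_ne_top _ _)]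
  have hc1 : (1 : ℝ) ≤ Fintype.card α := by exact_mod_cast Fintype.card_pos
  rw [klDiv_eq_lintegral_klFun_of_ac hac]
  have hae : μ.rnDeriv ν =ᵐ[ν] r := by
    rw [hμν]; exact Measure.rnDeriv_withDensity ν hrm
  have hνB : ∀ᵐ x ∂ν, p.map B x.2 ≠ 0 := by
    rw [ae_iff, prod_toMeasure_apply]
    refine ENNReal.tsum_eq_zero.2 fun x => ?_
    by_cases hx : p.map B x.2 = 0
    · simp [Set.indicator, hx]
    · rw [Set.indicator_of_notMem (by simpa using hx)]
  set N : Set (α × β) := {x | x.2 ∉ G}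
  calc ∫⁻ x, ENNReal.ofReal (klFun (μ.rnDeriv ν x).toReal) ∂ν
      ≤ ∫⁻ x, N.indicator (fun x => r x * ENNReal.ofReal (Real.log (Fintype.card α)) + 1) x ∂ν := by
        refine lintegral_mono_ae ?_
        filter_upwards [hae, hνB] with x hx hxB
        rw [hx]
        by_cases hxN : x ∈ N
        · rw [Set.indicator_of_mem hxN]
          have hrt : r x ≠ ∞ := ne_top_of_le_ne_top hct (hrc x)
          have := klFun_le (c := Fintype.card α) (ENNReal.toReal_nonneg (a := r x))
            (by have := ENNReal.toReal_mono hct (hrc x); simpa [hc] using this)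
          refine (ENNReal.ofReal_le_ofReal this).trans ?_
          rw [ENNReal.ofReal_add (mul_nonneg ENNReal.toReal_nonneg (Real.log_nonneg hc1)) zero_le_one,
            ENNReal.ofReal_mul ENNReal.toReal_nonneg, ENNReal.ofReal_toReal hrt, ENNReal.ofReal_one]
        · rw [hrG x (by simpa [N] using hxN) hxB]
          simp [klFun_one]
    _ = μ N * ENNReal.ofReal (Real.log (Fintype.card α)) + ν N := by
        rw [lintegral_indicator (.of_discrete), lintegral_add_right _ measurable_const,
          lintegral_mul_const _ hrm, hμν, withDensity_apply _ (.of_discrete)]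
        simp
    _ = _ := by
        have h1 : μ N = p.toOuterMeasure {ω | B ω ∉ G} := by
          rw [hμ, PMF.toMeasure_apply_eq_toOuterMeasure_apply _ (.of_discrete),
            PMF.toOuterMeasure_map_apply]
          rfl
        have h2 : ν N = p.toOuterMeasure {ω | B ω ∉ G} := by
          have : N = Set.univ ×ˢ Gᶜ := by ext; simp [N]
          rw [this, hν, Measure.prod_prod, measure_univ, one_mul,
            PMF.toMeasure_apply_eq_toOuterMeasure_apply _ (.of_discrete),
            PMF.toOuterMeasure_map_apply]
          rfl
        rw [h1, h2, ENNReal.ofReal_add (Real.log_nonneg hc1) zero_le_one, mul_add]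
        simp

end Information

/-! ### The law of an execution -/

section Law

variable {Y Z : Type} {n m : ℕ}

/-- The probability that the memoryless channel `W` maps `xs` to `(ys, zs)`. -/
def chanLik (W : Bool → PMF (Y × Z)) : List Bool → List Y → List Z → ℝ≥0∞
  | [], [], [] => 1
  | x :: xs, y :: ys, z :: zs => W x (y, z) * chanLik W xs ys zs
  | _, _, _ => 0

namespace Protocol

/-- Alice's factor in the likelihood of an execution; the steps are listed in reverse order. -/
def aliceLik (P : Protocol Y n m) (k : Strings m) : List Step → List Bool → List P.Msg → ℝ≥0∞
  | [], [], [] => 1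
  | .aliceMessage :: l, xs, g :: f => P.aliceMsg k xs f g * aliceLik P k l xs f
  | .bobMessage :: l, xs, _ :: f => aliceLik P k l xs f
  | .channelUse :: l, x :: xs, f => P.input k xs f x * aliceLik P k l xs f
  | _, _, _ => 0

/-- Bob's factor in the likelihood of an execution; the steps are listed in reverse order. -/
def bobLik (P : Protocol Y n m) (u : Bool) : List Step → List Y → List P.Msg → ℝ≥0∞
  | [], [], [] => 1
  | .bobMessage :: l, ys, g :: f => P.bobMsg u ys f g * bobLik P u l ys f
  | .aliceMessage :: l, ys, _ :: f => bobLik P u l ys f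
  | .channelUse :: l, _ :: ys, f => bobLik P u l ys f
  | _, _, _ => 0

lemma run_append (P : Protocol Y n m) (W : Bool → PMF (Y × Z)) (l₁ l₂ : List Step)
    (ω : Execution P.Msg Y Z m) :
    P.run W (l₁ ++ l₂) ω = (P.run W l₁ ω).bind (P.run W l₂) := by
  induction l₁ generalizing ω with
  | nil => simp [run]
  | cons s l ih =>
    simp only [List.cons_append, run, PMF.bind_bind]
    exact congrArg _ (funext ih)

open Classical in
-- Lists carry the newest entry first, so the last step performed matches the heads of the lists;
-- hence the schedule is reversed. A final execution has exactly one possible predecessor, obtained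
-- by deleting the newest entries, and each step multiplies just the factor of the party or channel
-- that acts.
lemma run_reverse_apply (P : Protocol Y n m) (W : Bool → PMF (Y × Z)) (k : Strings m) (u : Bool)
    (l : List Step) (ω : Execution P.Msg Y Z m) :
    P.run W l.reverse ⟨k, u, [], [], [], []⟩ ω =
      if ω.strings = k ∧ ω.choice = u then
        P.aliceLik k l ω.xs ω.transcript * (chanLik W ω.xs ω.ys ω.zs * P.bobLik u l ω.ys ω.transcript)
      else 0 := by
  induction l generalizing ω with
  | nil =>
    obtain ⟨k', u', xs, ys, zs, f⟩ := ω
    rcases xs with _ | ⟨x, xs⟩ <;> rcases ys with _ | ⟨y, ys⟩ <;> rcases zs with _ | ⟨z, zs⟩ <;>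
      rcases f with _ | ⟨g, f⟩ <;> simp [run, PMF.pure_apply, aliceLik, bobLik, chanLik]
  | cons s l ih =>
    rw [List.reverse_cons, run_append, PMF.bind_apply]
    have hrun : P.run W [s] = fun ω => P.step W ω s := by
      funext ω; simp only [run]; exact PMF.bind_pure _
    simp only [hrun, ih]
    obtain ⟨k', u', xs, ys, zs, f⟩ := ω
    cases s with
    | aliceMessage =>
      rcases f with _ | ⟨g, f⟩
      · simp [step, aliceLik, PMF.map_apply]
      · rw [tsum_eq_single ⟨k', u', xs, ys, zs, f⟩]
        · simp only [step, PMF.map_apply, Execution.mk.injEq, List.cons.injEq, true_and, and_true,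
            aliceLik, bobLik]
          rw [tsum_eq_single g (by intro b hb; simp [hb.symm])]
          rw [if_pos rfl]
          split_ifs with h
          · rw [h.1]; ring
          · simp
        · rintro ⟨k'', u'', xs', ys', zs', f'⟩ hne
          refine mul_eq_zero_of_right _ ?_
          simp only [step, PMF.map_apply, Execution.mk.injEq, List.cons.injEq]
          refine ENNReal.tsum_eq_zero.2 fun b => if_neg ?_
          rintro ⟨rfl, rfl, rfl, rfl, rfl, -, rfl⟩
          exact hne rfl
    | bobMessage =>
      rcases f with _ | ⟨g, f⟩
      · simp [step, aliceLik, PMF.map_apply]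
      · rw [tsum_eq_single ⟨k', u', xs, ys, zs, f⟩]
        · simp only [step, PMF.map_apply, Execution.mk.injEq, List.cons.injEq, true_and, and_true,
            aliceLik, bobLik]
          rw [tsum_eq_single g (by intro b hb; simp [hb.symm])]
          rw [if_pos rfl]
          split_ifs with h
          · rw [h.2]; ring
          · simp
        · rintro ⟨k'', u'', xs', ys', zs', f'⟩ hne
          refine mul_eq_zero_of_right _ ?_
          simp only [step, PMF.map_apply, Execution.mk.injEq, List.cons.injEq]
          refine ENNReal.tsum_eq_zero.2 fun b => if_neg ?_
          rintro ⟨rfl, rfl, rfl, rfl, rfl, -, rfl⟩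
          exact hne rfl
    | channelUse =>
      have happ : ∀ ω ω' : Execution P.Msg Y Z m, P.step W ω .channelUse ω' =
          ∑' x, P.input ω.strings ω.xs ω.transcript x * ∑' yz : Y × Z,
            if ω' = { ω with xs := x :: ω.xs, ys := yz.1 :: ω.ys, zs := yz.2 :: ω.zs }
              then W x yz else 0 := by
        intro ω ω'
        simp only [step, PMF.bind_apply, PMF.map_apply]
      simp only [happ]
      rcases xs with _ | ⟨x, xs⟩
      · simp [aliceLik]
      rcases ys with _ | ⟨y, ys⟩
      · simp [bobLik]
      rcases zs with _ | ⟨z, zs⟩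
      · simp [chanLik]
      rw [tsum_eq_single ⟨k', u', xs, ys, zs, f⟩]
      · simp only [Execution.mk.injEq, List.cons.injEq, true_and, and_true, aliceLik, bobLik,
          chanLik]
        rw [tsum_eq_single x (by intro b hb; simp [hb.symm]), tsum_eq_single (y, z)
          (by rintro ⟨b, c⟩ hb; rw [if_neg]; rintro ⟨-, rfl, rfl⟩; exact hb rfl)]
        split_ifs with h h'
        · rw [h.1]; ring
        · simp at h'
        · simp
        · simp
      · rintro ⟨k'', u'', xs', ys', zs', f'⟩ hne
        refine mul_eq_zero_of_right _ (ENNReal.tsum_eq_zero.2 fun b => mul_eq_zero_of_right _ ?_)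
        simp only [Execution.mk.injEq, List.cons.injEq]
        refine ENNReal.tsum_eq_zero.2 fun b => if_neg ?_
        rintro ⟨rfl, rfl, ⟨-, rfl⟩, ⟨-, rfl⟩, ⟨-, rfl⟩, rfl⟩
        exact hne rfl

/-- The law of an execution is the product of a factor of Alice, a factor of the channel and a
factor of Bob. -/
lemma law_apply (P : Protocol Y n m) (W : Bool → PMF (Y × Z)) (ω : Execution P.Msg Y Z m) :
    P.law W ω = (Fintype.card (Strings m × Bool) : ℝ≥0∞)⁻¹ *
      (P.aliceLik ω.strings P.schedule.reverse ω.xs ω.transcript *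
        (chanLik W ω.xs ω.ys ω.zs * P.bobLik ω.choice P.schedule.reverse ω.ys ω.transcript)) := by
  classical
  rw [law, PMF.bind_apply, tsum_eq_single (ω.strings, ω.choice)]
  · have := run_reverse_apply P W ω.strings ω.choice P.schedule.reverse ω
    rw [List.reverse_reverse] at this
    rw [this, if_pos ⟨rfl, rfl⟩, PMF.uniformOfFintype_apply]
  · rintro ⟨k, u⟩ hne
    have := run_reverse_apply P W k u P.schedule.reverse ω
    rw [List.reverse_reverse] at this
    rw [this, if_neg, mul_zero]
    rintro ⟨rfl, rfl⟩
    exact hne rfl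

lemma map_secrets_run (P : Protocol Y n m) (W : Bool → PMF (Y × Z)) (l : List Step)
    (ω : Execution P.Msg Y Z m) :
    (P.run W l ω).map Execution.secrets = PMF.pure ω.secrets := by
  induction l generalizing ω with
  | nil => simp [run, PMF.pure_map]
  | cons s l ih =>
    simp only [run, PMF.map_bind, ih]
    cases s
    · simp only [step, PMF.bind_map]
      exact PMF.bind_const _ (PMF.pure ω.secrets)
    · simp only [step, PMF.bind_map]
      exact PMF.bind_const _ (PMF.pure ω.secrets)
    · simp only [step, PMF.bind_map, PMF.bind_bind]
      have : ∀ x, ((W x).bind ((fun a : Execution P.Msg Y Z m => PMF.pure a.secrets) ∘ fun yz =>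
          { ω with xs := x :: ω.xs, ys := yz.1 :: ω.ys, zs := yz.2 :: ω.zs })) =
          PMF.pure ω.secrets := fun x => PMF.bind_const _ (PMF.pure ω.secrets)
      simp only [this, PMF.bind_const]

lemma map_secrets_law (P : Protocol Y n m) (W : Bool → PMF (Y × Z)) :
    (P.law W).map Execution.secrets = PMF.uniformOfFintype (Strings m × Bool) := by
  simp only [law, PMF.map_bind, map_secrets_run]
  exact PMF.bind_pure _

lemma aliceLik_eq_zero_of_length_ne (P : Protocol Y n m) (k : Strings m) (l : List Step)
    (xs : List Bool) (f : List P.Msg) (h : xs.length ≠ l.count .channelUse) :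
    P.aliceLik k l xs f = 0 := by
  induction l generalizing xs f with
  | nil => rcases xs with _ | ⟨x, xs⟩ <;> simp_all [aliceLik]
  | cons s l ih =>
    cases s
    · rcases f with _ | ⟨g, f⟩
      · simp [aliceLik]
      · rw [aliceLik, ih _ _ (by simpa using h), mul_zero]
    · rcases f with _ | ⟨g, f⟩
      · simp [aliceLik]
      · rw [aliceLik, ih _ _ (by simpa using h)]
    · rcases xs with _ | ⟨x, xs⟩
      · simp [aliceLik]
      · rw [aliceLik, ih _ _ (by simpa using h), mul_zero]

lemma length_xs_of_law_ne_zero (P : Protocol Y n m) (W : Bool → PMF (Y × Z))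
    {ω : Execution P.Msg Y Z m} (h : P.law W ω ≠ 0) : ω.xs.length = n := by
  by_contra hne
  refine h ?_
  rw [law_apply, aliceLik_eq_zero_of_length_ne, zero_mul, mul_zero]
  rwa [List.count_reverse, P.count_channelUse]

end Protocol

lemma chanLik_eq_zero_of_length_ne (W : Bool → PMF (Y × Z)) (xs : List Bool) (ys : List Y)
    (zs : List Z) (h : ¬ (ys.length = xs.length ∧ zs.length = xs.length)) :
    chanLik W xs ys zs = 0 := by
  induction xs generalizing ys zs with
  | nil => rcases ys with _ | ⟨y, ys⟩ <;> rcases zs with _ | ⟨z, zs⟩ <;> simp_all [chanLik]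
  | cons x xs ih =>
    rcases ys with _ | ⟨y, ys⟩ <;> rcases zs with _ | ⟨z, zs⟩
    · simp [chanLik]
    · simp [chanLik]
    · simp [chanLik]
    · rw [chanLik, ih _ _ (by simpa using h), mul_zero]

/-- Comparison of two channels whose transition probabilities differ by a factor that depends on
the outputs. -/
lemma chanLik_le (W W' : Bool → PMF (Y × Z)) (g : Y × Z → ℝ≥0∞)
    (h : ∀ x yz, W x yz ≤ g yz * W' x yz) (xs : List Bool) (ys : List Y) (zs : List Z) :
    chanLik W xs ys zs ≤ ((ys.zip zs).map g).prod * chanLik W' xs ys zs := by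
  induction xs generalizing ys zs with
  | nil => rcases ys with _ | ⟨y, ys⟩ <;> rcases zs with _ | ⟨z, zs⟩ <;> simp [chanLik]
  | cons x xs ih =>
    rcases ys with _ | ⟨y, ys⟩ <;> rcases zs with _ | ⟨z, zs⟩ <;> try simp [chanLik]
    calc W x (y, z) * chanLik W xs ys zs
        ≤ (g (y, z) * W' x (y, z)) * (((ys.zip zs).map g).prod * chanLik W' xs ys zs) := by
          gcongr
          · exact h _ _
          · exact ih _ _
      _ = _ := by ring

/-- Change of measure: the channel enters the law only through `chanLik`, so even for adaptive
inputs two channels can be compared letter by letter. -/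
lemma Protocol.law_le (P : Protocol Y n m) (W W' : Bool → PMF (Y × Z)) (g : Y × Z → ℝ≥0∞)
    (h : ∀ x yz, W x yz ≤ g yz * W' x yz) (ω : Execution P.Msg Y Z m) :
    P.law W ω ≤ ((ω.ys.zip ω.zs).map g).prod * P.law W' ω := by
  rw [P.law_apply, P.law_apply]
  calc _ ≤ (Fintype.card (Strings m × Bool) : ℝ≥0∞)⁻¹ *
      (P.aliceLik ω.strings P.schedule.reverse ω.xs ω.transcript *
        ((((ω.ys.zip ω.zs).map g).prod * chanLik W' ω.xs ω.ys ω.zs)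
          * P.bobLik ω.choice P.schedule.reverse ω.ys ω.transcript)) := by
        gcongr
        exact chanLik_le W W' g h _ _ _
    _ = _ := by ring

lemma prod_map_ite (T : Y × Z → Bool) (a b : ℝ≥0∞) (l : List (Y × Z)) :
    (l.map fun yz => if T yz then b * a else b).prod = b ^ l.length * a ^ l.countP T := by
  induction l with
  | nil => simp
  | cons yz l ih =>
    cases h : T yz <;> simp [h, ih, pow_succ] <;> ring

end Law

/-! ### Large deviations of the number of channel events -/

section Tail

/-- The Chernoff exponent: the moment generating function of a Bernoulli variable of mean `c` is at
most `exp (c t + O(t ^ 2))`, which is less than `exp (ν t)` for small `t`. -/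
lemma exists_exp_moment_lt {c ν : ℝ} (h0 : 0 ≤ c) (h1 : c ≤ 1) (h : c < ν) :
    ∃ t : ℝ, 0 < t ∧ 1 - c + c * Real.exp t < Real.exp (ν * t) := by
  -- With this `t` the quadratic error satisfies `c t ^ 2 ≤ t ^ 2 < (ν - c) t`.
  refine ⟨min 1 ((ν - c) / 2), lt_min one_pos (by linarith), ?_⟩
  set t := min 1 ((ν - c) / 2)
  have ht0 : 0 < t := lt_min one_pos (by linarith)
  have ht1 : t ≤ 1 := min_le_left _ _
  have ht2 : t ≤ (ν - c) / 2 := min_le_right _ _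
  have he := mul_le_mul_of_nonneg_left (exp_sub_one_le ht0.le ht1) h0
  have h2 := Real.add_one_le_exp (c * (t + t ^ 2))
  have h3 : c * (t + t ^ 2) < ν * t := by
    have : c * t ≤ t := mul_le_of_le_one_left ht0.le h1
    nlinarith
  calc 1 - c + c * Real.exp t ≤ Real.exp (c * (t + t ^ 2)) := by nlinarith
    _ < _ := Real.exp_lt_exp.2 h3

variable {Y Z : Type} {n m : ℕ}

/-- The channel obtained by giving the outputs in `T` the extra weight `w`. -/
def tiltedChannel (W : Bool → PMF (Y × Z)) (T : Y × Z → Bool) (w M : ℝ≥0∞)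
    (h : ∀ x, ∑' yz, W x yz * (if T yz then w else 1) * M⁻¹ = 1) (x : Bool) : PMF (Y × Z) :=
  ⟨fun yz => W x yz * (if T yz then w else 1) * M⁻¹, ENNReal.summable.hasSum_iff.2 (h x)⟩

lemma tsum_mul_ite (p : PMF (Y × Z)) (T : Y × Z → Bool) {c w : ℝ} (hc : 0 ≤ c) (hc1 : c ≤ 1)
    (hw : 0 ≤ w) (h : ∑' yz, (if T yz then p yz else 0) = ENNReal.ofReal c) :
    ∑' yz, p yz * (if T yz then ENNReal.ofReal w else 1) = ENNReal.ofReal (1 - c + c * w) := by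
  have h1 : ∑' yz, (if T yz then p yz else 0) + ∑' yz, (if T yz then 0 else p yz) = 1 := by
    rw [← ENNReal.tsum_add, ← p.tsum_coe]
    exact tsum_congr fun yz => by split_ifs <;> simp
  have h2 : ∑' yz, (if T yz then 0 else p yz) = ENNReal.ofReal (1 - c) := by
    rw [h] at h1
    rw [ENNReal.ofReal_sub _ hc, ENNReal.ofReal_one]
    exact ENNReal.eq_sub_of_add_eq ENNReal.ofReal_ne_top (by rw [add_comm]; exact h1)
  have h3 : ∀ yz, p yz * (if T yz then ENNReal.ofReal w else 1) =
      (if T yz then 0 else p yz) + (if T yz then p yz else 0) * ENNReal.ofReal w := by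
    intro yz; split_ifs <;> simp
  simp only [h3]
  rw [ENNReal.tsum_add, ENNReal.tsum_mul_right, h, h2, ← ENNReal.ofReal_mul hc,
    ← ENNReal.ofReal_add (by linarith) (by positivity)]

/-- If each channel use gives an output in `T` with probability `c`, whatever the input, then more
than a fraction `ν > c` of outputs in `T` is exponentially unlikely. -/
lemma exists_tail_bound (W : Bool → PMF (Y × Z)) (T : Y × Z → Bool) {c ν : ℝ} (hc : 0 ≤ c)
    (hc1 : c ≤ 1) (h : ∀ x, ∑' yz, (if T yz then W x yz else 0) = ENNReal.ofReal c) (hν : c < ν) :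
    ∃ q : ℝ≥0∞, q < 1 ∧ ∀ (n m : ℕ) (P : Protocol Y n m) (N : ℕ), ν * n ≤ N →
      (P.law W).toOuterMeasure {ω | N ≤ (ω.ys.zip ω.zs).countP T} ≤ q ^ n := by
  obtain ⟨t, ht, hlt⟩ := exists_exp_moment_lt hc hc1 hν
  set M := 1 - c + c * Real.exp t with hM
  have hM0 : 0 < M := by
    have := Real.one_le_exp ht.le
    nlinarith
  refine ⟨ENNReal.ofReal (M * Real.exp (-(ν * t))), ?_, fun n m P N hN => ?_⟩
  · rw [← ENNReal.ofReal_one, ENNReal.ofReal_lt_ofReal_iff one_pos, Real.exp_neg, ← div_eq_mul_inv,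
      div_lt_one (Real.exp_pos _)]
    exact hlt
  have hsum : ∀ x, ∑' yz, W x yz * (if T yz then ENNReal.ofReal (Real.exp t) else 1)
      * (ENNReal.ofReal M)⁻¹ = 1 := by
    intro x
    rw [ENNReal.tsum_mul_right, tsum_mul_ite (W x) T hc hc1 (Real.exp_pos t).le (h x)]
    exact ENNReal.mul_inv_cancel (by simpa using hM0) ENNReal.ofReal_ne_top
  -- Exponential tilting of the channel. The normaliser `M` is the same for every input, so the
  -- tilted weights form a channel on which the same protocol runs; comparing the two laws replaces
  -- an independence argument, which adaptive inputs would not allow.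
  set W' := tiltedChannel W T _ _ hsum with hW'
  have hle : ∀ x yz, W x yz ≤ (fun yz => if T yz then ENNReal.ofReal M * ENNReal.ofReal
      (Real.exp (-t)) else ENNReal.ofReal M) yz * W' x yz := by
    intro x yz
    refine le_of_eq ?_
    change _ = _ * (W x yz * (if T yz then ENNReal.ofReal (Real.exp t) else 1)
      * (ENNReal.ofReal M)⁻¹)
    have h1 : ENNReal.ofReal M * (ENNReal.ofReal M)⁻¹ = 1 :=
      ENNReal.mul_inv_cancel (by simpa using hM0) ENNReal.ofReal_ne_top
    have h2 : ENNReal.ofReal (Real.exp (-t)) * ENNReal.ofReal (Real.exp t) = 1 := by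
      rw [← ENNReal.ofReal_mul (Real.exp_pos _).le, ← Real.exp_add]; simp
    dsimp only
    split_ifs
    · calc W x yz = W x yz * (ENNReal.ofReal M * (ENNReal.ofReal M)⁻¹) *
          (ENNReal.ofReal (Real.exp (-t)) * ENNReal.ofReal (Real.exp t)) := by rw [h1, h2]; simp
        _ = _ := by ring
    · calc W x yz = W x yz * (ENNReal.ofReal M * (ENNReal.ofReal M)⁻¹) := by rw [h1]; simp
        _ = _ := by ring
  have hpt : ∀ ω : Execution P.Msg Y Z m, Set.indicator {ω : Execution P.Msg Y Z m |
      N ≤ (ω.ys.zip ω.zs).countP T} (P.law W) ω ≤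
      ENNReal.ofReal (M * Real.exp (-(ν * t))) ^ n * P.law W' ω := by
    intro ω
    by_cases hω : ω ∈ {ω : Execution P.Msg Y Z m | N ≤ (ω.ys.zip ω.zs).countP T}
    swap
    · rw [Set.indicator_of_notMem hω]; exact bot_le
    rw [Set.indicator_of_mem hω]
    by_cases h0 : P.law W ω = 0
    · rw [h0]; exact bot_le
    refine (P.law_le W W' _ hle ω).trans ?_
    gcongr
    have hlen : (ω.ys.zip ω.zs).length = n := by
      have h1 := P.length_xs_of_law_ne_zero W h0
      have h2 : chanLik W ω.xs ω.ys ω.zs ≠ 0 := by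
        intro h2; exact h0 (by rw [P.law_apply, h2]; simp)
      have h3 := not_imp_comm.1 (chanLik_eq_zero_of_length_ne W ω.xs ω.ys ω.zs) h2
      rw [List.length_zip, h3.1, h3.2, h1, min_self]
    rw [prod_map_ite, hlen, ← ENNReal.ofReal_pow hM0.le, ← ENNReal.ofReal_pow (Real.exp_pos _).le,
      ← ENNReal.ofReal_pow (by positivity), ← ENNReal.ofReal_mul (by positivity)]
    refine ENNReal.ofReal_le_ofReal ?_
    rw [mul_pow]
    gcongr
    rw [← Real.exp_nat_mul, ← Real.exp_nat_mul, Real.exp_le_exp]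
    have : (N : ℝ) ≤ ((ω.ys.zip ω.zs).countP T : ℕ) := by exact_mod_cast hω
    nlinarith
  rw [PMF.toOuterMeasure_apply]
  calc _ ≤ ∑' ω, ENNReal.ofReal (M * Real.exp (-(ν * t))) ^ n * P.law W' ω := ENNReal.tsum_le_tsum hpt
    _ = _ := by rw [ENNReal.tsum_mul_left, PMF.tsum_coe, mul_one]

end Tail

/-! ### The degraded erasure channel -/

section Degraded

variable (ε₁ ε₂ : unitInterval)

lemma bec_apply (ε : unitInterval) (x : Bool) (y : Option Bool) :
    bec ε x y = if y = none then ENNReal.ofReal ε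
      else if y = some x then ENNReal.ofReal (1 - ε) else 0 := rfl

lemma degradedBEC_apply (x : Bool) (yz : Option Bool × Option Bool) :
    degradedBEC ε₁ ε₂ x yz = bec ε₁ x yz.1 * becStage ε₂ yz.1 yz.2 := by
  classical
  obtain ⟨y, z⟩ := yz
  rw [degradedBEC, PMF.bind_apply, tsum_eq_single y]
  · rw [PMF.map_apply, tsum_eq_single z]
    · simp
    · intro b hb; simp [hb.symm]
  · intro b hb
    rw [PMF.map_apply]
    simp [hb.symm]

lemma tsum_degradedBEC_erased (x : Bool) :
    ∑' yz, (if (fun yz : Option Bool × Option Bool => yz.1.isNone) yz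
      then degradedBEC ε₁ ε₂ x yz else 0) = ENNReal.ofReal ε₁ := by
  rw [tsum_fintype, Fintype.sum_prod_type]
  simp [Fintype.sum_option, degradedBEC_apply, bec_apply, becStage, PMF.pure_apply]

lemma tsum_degradedBEC_secret (x : Bool) :
    ∑' yz, (if (fun yz : Option Bool × Option Bool => yz.1.isSome && yz.2.isNone) yz
      then degradedBEC ε₁ ε₂ x yz else 0) = ENNReal.ofReal (ε₂ * (1 - ε₁)) := by
  rw [tsum_fintype, Fintype.sum_prod_type, mul_comm, ENNReal.ofReal_mul (by linarith [ε₁.2.2])]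
  cases x <;> simp [Fintype.sum_option, degradedBEC_apply, bec_apply, becStage]

end Degraded

/-! ### Marginal laws -/

section Marginals

variable {Y Z : Type} {n m : ℕ}

lemma map_uniformOfFintype_fst {α β γ : Type} [Fintype α] [Fintype β] [Fintype γ] [Nonempty α]
    [Nonempty β] (e : α ≃ β × γ) :
    (PMF.uniformOfFintype α).map (fun a => (e a).1) = PMF.uniformOfFintype β := by
  classical
  ext b
  have hγ : Nonempty γ := ⟨(e (Classical.arbitrary α)).2⟩
  rw [PMF.map_apply, tsum_fintype, ← e.symm.sum_comp, Fintype.sum_prod_type]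
  simp only [Equiv.apply_symm_apply, PMF.uniformOfFintype_apply, Fintype.card_congr e,
    Fintype.card_prod, Nat.cast_mul]
  rw [Finset.sum_eq_single b (by intro x _ hx; simp [hx.symm]) (by simp)]
  simp only [if_true, Finset.sum_const, Finset.card_univ, nsmul_eq_mul]
  rw [ENNReal.mul_inv (by simp) (by simp), mul_left_comm, ENNReal.mul_inv_cancel (by simp) (by simp),
    mul_one]

/-- Separates the two strings of Alice according to a choice bit. -/
def secretsEquiv (m : ℕ) : Strings m × Bool ≃ (Fin m → Bool) × (Fin m → Bool) × Bool where
  toFun d := (d.1 (!d.2), d.1 d.2, d.2)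
  invFun e := (fun b => if b = e.2.2 then e.2.1 else e.1, e.2.2)
  left_inv := by
    rintro ⟨k, u⟩
    refine Prod.ext (funext fun b => ?_) rfl
    cases b <;> cases u <;> simp
  right_inv := by
    rintro ⟨a, b, u⟩
    cases u <;> simp

namespace Protocol

lemma map_choice_law (P : Protocol Y n m) (W : Bool → PMF (Y × Z)) :
    (P.law W).map Execution.choice = PMF.uniformOfFintype Bool := by
  rw [← map_uniformOfFintype_fst (Equiv.prodComm (Strings m) Bool), ← P.map_secrets_law W,
    PMF.map_comp]
  rfl

lemma map_unchosen_law (P : Protocol Y n m) (W : Bool → PMF (Y × Z)) :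
    (P.law W).map Execution.unchosen = PMF.uniformOfFintype (Fin m → Bool) := by
  rw [← map_uniformOfFintype_fst (secretsEquiv m), ← P.map_secrets_law W, PMF.map_comp]
  rfl

lemma toOuterMeasure_choice (P : Protocol Y n m) (W : Bool → PMF (Y × Z)) (b : Bool) :
    (P.law W).toOuterMeasure {ω | ω.choice = b} = 2⁻¹ := by
  have h := PMF.toOuterMeasure_map_apply Execution.choice (P.law W) {b}
  change _ = (P.law W).toOuterMeasure {ω | ω.choice = b} at h
  rw [← h, map_choice_law, PMF.toOuterMeasure_apply_singleton, PMF.uniformOfFintype_apply]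
  simp

end Protocol

end Marginals

/-! ### The upper bound from the privacy of Alice and Bob -/

section OTBound

variable {Y Z : Type} {n m : ℕ}

/-- Executions as tuples, with Alice's strings separated. -/
def executionEquivStrings (Msg Y Z : Type) (m : ℕ) :
    (Bool × List Bool × List Y × List Z × List Msg) × Strings m ≃ Execution Msg Y Z m where
  toFun t := ⟨t.2, t.1.1, t.1.2.1, t.1.2.2.1, t.1.2.2.2.1, t.1.2.2.2.2⟩
  invFun ω := ((ω.choice, ω.xs, ω.ys, ω.zs, ω.transcript), ω.strings)
  left_inv _ := rfl
  right_inv _ := rfl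

/-- The inputs of the erasure channel that are compatible with a given output. -/
def compatibleInputs : List (Option Bool) → List (List Bool)
  | [] => [[]]
  | none :: ys => (compatibleInputs ys).map (true :: ·) ++ (compatibleInputs ys).map (false :: ·)
  | some b :: ys => (compatibleInputs ys).map (b :: ·)

lemma length_compatibleInputs (ys : List (Option Bool)) :
    (compatibleInputs ys).length = 2 ^ ys.countP Option.isNone := by
  induction ys with
  | nil => simp [compatibleInputs]
  | cons y ys ih => rcases y with _ | b <;> simp [compatibleInputs, ih, pow_succ, mul_two]

lemma mem_compatibleInputs (W : Bool → PMF (Option Bool × Z))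
    (hW : ∀ x yz, W x yz ≠ 0 → yz.1 = none ∨ yz.1 = some x) (xs : List Bool)
    (ys : List (Option Bool)) (zs : List Z) (h : chanLik W xs ys zs ≠ 0) :
    xs ∈ compatibleInputs ys := by
  induction xs generalizing ys zs with
  | nil =>
    rcases ys with _ | ⟨y, ys⟩ <;> rcases zs with _ | ⟨z, zs⟩ <;>
      simp_all [chanLik, compatibleInputs]
  | cons x xs ih =>
    rcases ys with _ | ⟨y, ys⟩ <;> rcases zs with _ | ⟨z, zs⟩ <;> try simp [chanLik] at h
    have h1 := ih ys zs h.2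
    rcases hW x (y, z) h.1 with h2 | h2 <;> simp only at h2 <;> subst h2
    · cases x <;> simp [compatibleInputs, h1]
    · simp [compatibleInputs, h1]

namespace Protocol

open Classical in
/-- The total weight of Alice's strings whose component `K₁` is `s`. -/
def aliceMass (P : Protocol Y n m) (xs : List Bool) (f : List P.Msg) (s : Fin m → Bool) : ℝ≥0∞ :=
  ∑ k : Strings m, if k true = s then P.aliceLik k P.schedule.reverse xs f else 0

/-- The maximum a posteriori rule for `K₁`. It needs only `(X, F)`, because `aliceLik` is the only
factor of the law that involves the strings. -/
lemma exists_guess (P : Protocol Y n m) :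
    ∃ g : List Bool → List P.Msg → Fin m → Bool,
      ∀ xs f s, P.aliceMass xs f s ≤ P.aliceMass xs f (g xs f) := by
  choose g hg using fun xs f => Finite.exists_max (P.aliceMass xs f)
  exact ⟨g, hg⟩

/-- Given Alice's inputs and the transcript, the best guess of `K₁` is at least as good as Bob's
estimate. -/
lemma toOuterMeasure_estimate_le_guess (P : Protocol Y n m) (W : Bool → PMF (Y × Z))
    (g : List Bool → List P.Msg → Fin m → Bool)
    (hg : ∀ xs f s, P.aliceMass xs f s ≤ P.aliceMass xs f (g xs f)) :
    (P.law W).toOuterMeasure {ω | ω.choice = true ∧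
        ω.strings true = P.estimate ω.choice ω.ys ω.transcript} ≤
      (P.law W).toOuterMeasure {ω | ω.choice = true ∧ ω.strings true = g ω.xs ω.transcript} := by
  classical
  -- For an estimator that does not see the strings, summing over them first leaves a weight free of
  -- `k` times `aliceMass` at the estimate; the optimal guess therefore wins term by term.
  have key : ∀ e : Bool → List Bool → List Y → List P.Msg → Fin m → Bool,
      (P.law W).toOuterMeasure {ω | ω.choice = true ∧
        ω.strings true = e ω.choice ω.xs ω.ys ω.transcript} =
      ∑' t : Bool × List Bool × List Y × List Z × List P.Msg, if t.1 = true then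
        (Fintype.card (Strings m × Bool) : ℝ≥0∞)⁻¹ *
          (chanLik W t.2.1 t.2.2.1 t.2.2.2.1 * P.bobLik t.1 P.schedule.reverse t.2.2.1 t.2.2.2.2) *
          P.aliceMass t.2.1 t.2.2.2.2 (e t.1 t.2.1 t.2.2.1 t.2.2.2.2) else 0 := by
    intro e
    rw [PMF.toOuterMeasure_apply, ← (executionEquivStrings P.Msg Y Z m).tsum_eq, ENNReal.tsum_prod']
    refine tsum_congr fun t => ?_
    rw [tsum_fintype]
    split_ifs with ht
    · rw [aliceMass, Finset.mul_sum]
      refine Finset.sum_congr rfl fun k _ => ?_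
      simp only [Set.indicator, executionEquivStrings, Equiv.coe_fn_mk, Set.mem_ofPred_eq, ht,
        true_and, P.law_apply]
      split_ifs
      · ring
      · simp
    · refine Finset.sum_eq_zero fun k _ => ?_
      simp [Set.indicator, executionEquivStrings, ht]
  rw [key (fun u _ y f => P.estimate u y f), key (fun _ x _ f => g x f)]
  refine ENNReal.tsum_le_tsum fun t => ?_
  split_ifs
  · gcongr
    exact hg _ _ _
  · exact le_rfl

/-- Near independence of `U` and Alice's view gives `a ≤ (a + b) / 2 + τ` for the probabilities `a`,
`b` of the event with `U = 1` and `U = 0`; solving for `a` doubles the error. -/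
lemma toOuterMeasure_viewA_le (P : Protocol Y n m) (W : Bool → PMF (Y × Z))
    (H : Set (Strings m × List Bool × List P.Msg)) {δ : ℝ} (h0 : 0 < δ) (h1 : δ ≤ 1) :
    (P.law W).toOuterMeasure {ω | ω.choice = true ∧ ω.viewA ∈ H} ≤
      (P.law W).toOuterMeasure {ω | ω.choice = false ∧ ω.viewA ∈ H} +
        2 * (ENNReal.ofReal δ + P.leakToAlice W / ENNReal.ofReal δ) := by
  have := P.countable_msg
  set τ := ENNReal.ofReal δ + P.leakToAlice W / ENNReal.ofReal δ with hτ
  set a := (P.law W).toOuterMeasure {ω | ω.choice = true ∧ ω.viewA ∈ H}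
  set b := (P.law W).toOuterMeasure {ω | ω.choice = false ∧ ω.viewA ∈ H}
  have h2 : a ≤ 2⁻¹ * (P.law W).toOuterMeasure {ω | ω.viewA ∈ H} + τ := by
    refine (toOuterMeasure_le_add_mutualInfo (P.law W) Execution.choice Execution.viewA
      {t | t.1 = true ∧ t.2 ∈ H} h0 h1).trans (le_of_eq ?_)
    rw [hτ, leakToAlice]
    congr 1
    rw [ENNReal.tsum_prod', tsum_bool]
    have h3 := PMF.toOuterMeasure_map_apply Execution.viewA (P.law W) H
    change _ = (P.law W).toOuterMeasure {ω | ω.viewA ∈ H} at h3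
    rw [← h3, PMF.toOuterMeasure_apply, ← ENNReal.tsum_mul_left]
    have h4 : ∀ v, Set.indicator {t : Bool × Strings m × List Bool × List P.Msg |
        t.1 = true ∧ t.2 ∈ H} (fun x => (P.law W).map Execution.choice x.1 *
          (P.law W).map Execution.viewA x.2) (false, v) = 0 := fun v => by simp [Set.indicator]
    simp only [h4, tsum_zero, zero_add]
    refine tsum_congr fun v => ?_
    by_cases hv : v ∈ H <;>
      simp [Set.indicator, hv, P.map_choice_law, PMF.uniformOfFintype_apply]
  have h3 : (P.law W).toOuterMeasure {ω | ω.viewA ∈ H} ≤ a + b := by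
    refine (MeasureTheory.measure_mono fun ω hω => ?_).trans (MeasureTheory.measure_union_le _ _)
    cases h : ω.choice
    · exact Or.inr ⟨h, hω⟩
    · exact Or.inl ⟨h, hω⟩
  have ha : a ≠ ∞ := by
    refine ne_top_of_le_ne_top (b := 1) ENNReal.one_ne_top ?_
    rw [← (P.law W).tsum_coe]
    change (P.law W).toOuterMeasure _ ≤ _
    rw [PMF.toOuterMeasure_apply]
    exact ENNReal.tsum_le_tsum fun ω => Set.indicator_le_self _ _ _
  have h4 : a + a ≤ a + (b + 2 * τ) := by
    calc a + a = 2 * a := (two_mul a).symm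
      _ ≤ 2 * (2⁻¹ * (a + b) + τ) := by gcongr; exact h2.trans (by gcongr)
      _ = 2 * 2⁻¹ * (a + b) + 2 * τ := by ring
      _ = _ := by rw [ENNReal.mul_inv_cancel (by simp) (by simp)]; ring
  exact (ENNReal.add_le_add_iff_left ha).1 h4

/-- The number of values of `K₁` that Bob cannot exclude is at most exponential in the number of
erasures. -/
lemma toOuterMeasure_guess_le (P : Protocol (Option Bool) n m) (W : Bool → PMF (Option Bool × Z))
    (hW : ∀ x yz, W x yz ≠ 0 → yz.1 = none ∨ yz.1 = some x)
    (g : List Bool → List P.Msg → Fin m → Bool) (N : ℕ) {δ : ℝ} (h0 : 0 < δ) (h1 : δ ≤ 1) :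
    (P.law W).toOuterMeasure {ω | ω.choice = false ∧ ω.strings true = g ω.xs ω.transcript} ≤
      (P.law W).toOuterMeasure {ω | N + 1 ≤ (ω.ys.zip ω.zs).countP fun yz => yz.1.isNone} +
        (2 ^ N * (2 ^ m)⁻¹ + (ENNReal.ofReal δ + P.leakToBob W / ENNReal.ofReal δ)) := by
  classical
  have := P.countable_msg
  -- Bob's list decoder: apply the guess to every input sequence compatible with his outputs. When
  -- at most `N` symbols are erased, the list has at most `2 ^ N` entries.
  set L : Set ((Fin m → Bool) × (Bool × List (Option Bool) × List P.Msg)) :=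
    {t | t.2.2.1.countP Option.isNone ≤ N ∧
      t.1 ∈ (compatibleInputs t.2.2.1).map fun xs => g xs t.2.2.2} with hL
  have hν : ∑' x, L.indicator (fun x => (P.law W).map Execution.unchosen x.1 *
      (P.law W).map Execution.viewB x.2) x ≤ 2 ^ N * (2 ^ m)⁻¹ := by
    rw [(Equiv.prodComm _ _).symm.tsum_eq _ |>.symm, ENNReal.tsum_prod']
    calc _ ≤ ∑' v, 2 ^ N * (2 ^ m)⁻¹ * (P.law W).map Execution.viewB v := by
          refine ENNReal.tsum_le_tsum fun v => ?_
          by_cases hv : v.2.1.countP Option.isNone ≤ N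
          · set l := (compatibleInputs v.2.1).map fun xs => g xs v.2.2 with hl
            have hcard : (l.toFinset.card : ℝ≥0∞) ≤ 2 ^ N := by
              have h2 := l.toFinset_card_le
              rw [hl, List.length_map, length_compatibleInputs] at h2
              exact_mod_cast h2.trans (Nat.pow_le_pow_right two_pos hv)
            have h3 : ∀ s, L.indicator (fun x => (P.law W).map Execution.unchosen x.1 *
                (P.law W).map Execution.viewB x.2) ((Equiv.prodComm _ _).symm (v, s)) =
                if s ∈ l.toFinset then (2 ^ m)⁻¹ * (P.law W).map Execution.viewB v else 0 := by
              intro s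
              simp only [Set.indicator, hL, Set.mem_ofPred_eq, Equiv.prodComm_symm,
                Equiv.prodComm_apply, Prod.swap_prod_mk, hv, true_and, P.map_unchosen_law,
                PMF.uniformOfFintype_apply, List.mem_toFinset, ← hl]
              simp
            simp only [h3]
            rw [tsum_fintype, Finset.sum_ite_mem, Finset.univ_inter, Finset.sum_const, nsmul_eq_mul,
              ← mul_assoc]
            gcongr
          · simp [Set.indicator, hL, hv]
      _ = _ := by rw [ENNReal.tsum_mul_left, PMF.tsum_coe, mul_one]
  have hL' := toOuterMeasure_le_add_mutualInfo (P.law W) Execution.unchosen Execution.viewB L h0 h1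
  refine (PMF.toOuterMeasure_mono (P.law W) (t := {ω | N + 1 ≤ (ω.ys.zip ω.zs).countP fun yz => yz.1.isNone} ∪
    {ω | (ω.unchosen, ω.viewB) ∈ L}) ?_).trans ((MeasureTheory.measure_union_le _ _).trans ?_)
  -- As `U = 0`, the guessed string `K₁` is the unchosen one. On the support of the law the true
  -- input sequence is compatible with Bob's outputs, so its guess is in the list.
  · rintro ω ⟨⟨hu, hs⟩, hω⟩
    rw [PMF.mem_support_iff] at hω
    have h2 : chanLik W ω.xs ω.ys ω.zs ≠ 0 := by
      intro h2; exact hω (by rw [P.law_apply, h2]; simp)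
    have hlen := not_imp_comm.1 (chanLik_eq_zero_of_length_ne W ω.xs ω.ys ω.zs) h2
    have hcount : (ω.ys.zip ω.zs).countP (fun yz => yz.1.isNone) = ω.ys.countP Option.isNone := by
      conv_rhs => rw [← List.map_fst_zip (l₁ := ω.ys) (l₂ := ω.zs) (by omega), List.countP_map]
      rfl
    by_cases hN : N + 1 ≤ (ω.ys.zip ω.zs).countP fun yz => yz.1.isNone
    · exact Or.inl hN
    · refine Or.inr ⟨?_, ?_⟩
      · simp only [Execution.viewB]; omega
      · refine List.mem_map.2 ⟨ω.xs, mem_compatibleInputs W hW _ _ _ h2, ?_⟩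
        simp [Execution.unchosen, Execution.viewB, hu, hs]
  · rw [leakToBob]
    gcongr
    exact hL'.trans (by gcongr)

/-- The event `U = 1` has probability `1 / 2`. Apart from decoding errors it passes from Bob's
estimate to the guess from `(X, F)`, from `U = 1` to `U = 0` by Alice's ignorance, and to Bob's
short list by his ignorance of the unchosen string. -/
lemma half_le_of_erasures (P : Protocol (Option Bool) n m) (W : Bool → PMF (Option Bool × Z))
    (hW : ∀ x yz, W x yz ≠ 0 → yz.1 = none ∨ yz.1 = some x) (N : ℕ) {δ : ℝ} (h0 : 0 < δ)
    (h1 : δ ≤ 1) :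
    2⁻¹ ≤ P.errorProb W + (((P.law W).toOuterMeasure
        {ω | N + 1 ≤ (ω.ys.zip ω.zs).countP fun yz => yz.1.isNone} +
        (2 ^ N * (2 ^ m)⁻¹ + (ENNReal.ofReal δ + P.leakToBob W / ENNReal.ofReal δ))) +
        2 * (ENNReal.ofReal δ + P.leakToAlice W / ENNReal.ofReal δ)) := by
  obtain ⟨g, hg⟩ := P.exists_guess
  rw [← P.toOuterMeasure_choice W true]
  refine (MeasureTheory.measure_mono (t := {ω | P.estimate ω.choice ω.ys ω.transcript ≠ ω.chosen} ∪
    {ω | ω.choice = true ∧ ω.strings true = P.estimate ω.choice ω.ys ω.transcript}) ?_).trans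
    ((MeasureTheory.measure_union_le _ _).trans ?_)
  · intro ω hω
    by_cases h : P.estimate ω.choice ω.ys ω.transcript = ω.chosen
    · refine Or.inr ⟨hω, ?_⟩
      rw [h, Execution.chosen, show ω.choice = true from hω]
    · exact Or.inl h
  · rw [errorProb]
    gcongr
    refine (P.toOuterMeasure_estimate_le_guess W g hg).trans ?_
    refine (P.toOuterMeasure_viewA_le W {a | a.1 true = g a.2.1 a.2.2} h0 h1).trans ?_
    gcongr
    exact P.toOuterMeasure_guess_le W hW g N h0 h1

end Protocol

end OTBound

/-! ### The upper bound from the secrecy against Eve -/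

section KeyBound

variable {Y Z : Type} {n m : ℕ}

/-- The product of the weights of corresponding entries of two lists of the same length. -/
def zipLik {A B : Type} (c : A → B → ℝ≥0∞) : List A → List B → ℝ≥0∞
  | [], [] => 1
  | a :: as, b :: bs => c a b * zipLik c as bs
  | _, _ => 0

lemma chanLik_eq_mul_zipLik (W : Bool → PMF (Y × Z)) (a : Bool → Z → ℝ≥0∞) (b : Y → Z → ℝ≥0∞)
    (h : ∀ x y z, W x (y, z) = a x z * b y z) (xs : List Bool) (ys : List Y) (zs : List Z) :
    chanLik W xs ys zs = if ys.length = xs.length then zipLik a xs zs * zipLik b ys zs else 0 := by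
  induction xs generalizing ys zs with
  | nil => rcases ys with _ | ⟨y, ys⟩ <;> rcases zs with _ | ⟨z, zs⟩ <;> simp [chanLik, zipLik]
  | cons x xs ih =>
    rcases ys with _ | ⟨y, ys⟩ <;> rcases zs with _ | ⟨z, zs⟩ <;> try simp [chanLik, zipLik]
    rw [ih, h]
    split_ifs
    · ring
    · simp

lemma zipLik_eq_zero_of_length_ne {A B : Type} (c : A → B → ℝ≥0∞) (as : List A) (bs : List B)
    (h : as.length ≠ bs.length) : zipLik c as bs = 0 := by
  induction as generalizing bs with
  | nil => rcases bs with _ | ⟨b, bs⟩ <;> simp_all [zipLik]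
  | cons a as ih =>
    rcases bs with _ | ⟨b, bs⟩
    · simp [zipLik]
    · rw [zipLik, ih bs (by simpa using h), mul_zero]

/-- A product `a x z * b y z` means that Bob's output and the input are conditionally independent
given Eve's output; for sequences, this lets `ys` be summed out with Alice's data fixed. -/
lemma chanLik_eq_zipLik (W : Bool → PMF (Y × Z)) (a : Bool → Z → ℝ≥0∞) (b : Y → Z → ℝ≥0∞)
    (h : ∀ x y z, W x (y, z) = a x z * b y z) (xs : List Bool) (ys : List Y) (zs : List Z) :
    chanLik W xs ys zs = zipLik a xs zs * zipLik b ys zs := by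
  rw [chanLik_eq_mul_zipLik W a b h]
  split_ifs with hl
  · rfl
  · by_cases h1 : xs.length = zs.length
    · rw [zipLik_eq_zero_of_length_ne b ys zs (by omega), mul_zero]
    · rw [zipLik_eq_zero_of_length_ne a xs zs h1, zero_mul]

/-- Executions as tuples, with Bob's outputs separated. -/
def executionEquivOutputs (Msg Y Z : Type) (m : ℕ) :
    ((Strings m × Bool) × List Bool × List Z × List Msg) × List Y ≃ Execution Msg Y Z m where
  toFun t := ⟨t.1.1.1, t.1.1.2, t.1.2.1, t.2, t.1.2.2.1, t.1.2.2.2⟩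
  invFun ω := (((ω.strings, ω.choice), ω.xs, ω.zs, ω.transcript), ω.ys)
  left_inv _ := rfl
  right_inv _ := rfl

lemma sum_strings_apply (u : Bool) (g : (Fin m → Bool) → ℝ≥0∞) :
    ∑ k : Strings m, g (k u) = 2 ^ m * ∑ s, g s := by
  rw [← (Equiv.boolArrowEquivProd (Fin m → Bool)).symm.sum_comp, Fintype.sum_prod_type]
  cases u
  · simp [Equiv.boolArrowEquivProd, Finset.mul_sum]
  · simp [Equiv.boolArrowEquivProd]

namespace Protocol

/-- The total weight of Bob's outputs, given Eve's outputs and the transcript. -/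
def bobMass (P : Protocol Y n m) (b : Y → Z → ℝ≥0∞) (u : Bool) (zs : List Z) (f : List P.Msg) :
    ℝ≥0∞ :=
  ∑' ys, zipLik b ys zs * P.bobLik u P.schedule.reverse ys f

open Classical in
/-- The total weight of Bob's outputs that lead to the estimate `s`, given Eve's outputs and the
transcript. -/
def estimateMass (P : Protocol Y n m) (b : Y → Z → ℝ≥0∞) (u : Bool) (zs : List Z) (f : List P.Msg)
    (s : Fin m → Bool) : ℝ≥0∞ :=
  ∑' ys, if P.estimate u ys f = s then zipLik b ys zs * P.bobLik u P.schedule.reverse ys f else 0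

lemma sum_estimateMass (P : Protocol Y n m) (b : Y → Z → ℝ≥0∞) (u : Bool) (zs : List Z)
    (f : List P.Msg) : ∑ s, P.estimateMass b u zs f s = P.bobMass b u zs f := by
  simp only [estimateMass, bobMass]
  rw [← tsum_fintype (L := .unconditional _), ENNReal.tsum_comm]
  exact tsum_congr fun ys => by rw [tsum_fintype]; simp

/-- The pairs of secrets and views of Eve for which the chosen string is an unusually likely value
of Bob's estimate. -/
def likelyEstimates (P : Protocol Y n m) (b : Y → Z → ℝ≥0∞) (t c : ℝ≥0∞) :
    Set ((Strings m × Bool) × (List Z × List P.Msg)) :=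
  {v | t * P.bobMass b v.1.2 v.2.1 v.2.2 < c * P.estimateMass b v.1.2 v.2.1 v.2.2 (v.1.1 v.1.2)}

/-- Markov's inequality: the estimate masses add up to `bobMass`, so at most `c / t` strings can be
likely. The factor `2 ^ m` counts the free unchosen string and the factor 2 the choice bit. -/
lemma sum_likelyEstimates_le (P : Protocol Y n m) (b : Y → Z → ℝ≥0∞) {t c : ℝ≥0∞} (ht : t ≠ 0)
    (ht' : t ≠ ∞) (v : List Z × List P.Msg) :
    ∑ d : Strings m × Bool, (P.likelyEstimates b t c).indicator (fun _ => 1) (d, v) ≤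
      2 * 2 ^ m * (c / t) := by
  rw [Fintype.sum_prod_type_right]
  have h : ∀ u : Bool, ∑ k : Strings m,
      (P.likelyEstimates b t c).indicator (fun _ => (1 : ℝ≥0∞)) ((k, u), v) ≤
        2 ^ m * (c / t) := by
    intro u
    -- Strictness in `likelyEstimates` makes the numerator nonzero and the denominator finite, so
    -- the ratio is at least 1 on the set even if `bobMass` vanishes.
    calc _ ≤ ∑ k : Strings m, c * P.estimateMass b u v.1 v.2 (k u) / (t * P.bobMass b u v.1 v.2) := by
          refine Finset.sum_le_sum fun k _ => ?_
          by_cases hk : ((k, u), v) ∈ P.likelyEstimates b t c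
          · rw [Set.indicator_of_mem hk]
            change t * P.bobMass b u v.1 v.2 < c * P.estimateMass b u v.1 v.2 (k u) at hk
            rw [ENNReal.le_div_iff_mul_le (Or.inr (ne_bot_of_gt hk)) (Or.inl (ne_top_of_lt hk)),
              one_mul]
            exact hk.le
          · rw [Set.indicator_of_notMem hk]; exact bot_le
      _ = 2 ^ m * (c * P.bobMass b u v.1 v.2 / (t * P.bobMass b u v.1 v.2)) := by
          rw [sum_strings_apply u
            fun s => c * P.estimateMass b u v.1 v.2 s / (t * P.bobMass b u v.1 v.2)]
          simp only [div_eq_mul_inv]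
          rw [← Finset.sum_mul, ← Finset.mul_sum, sum_estimateMass]
      _ ≤ _ := by
          gcongr 2 ^ m * ?_
          refine ENNReal.div_le_of_le_mul (le_of_eq ?_)
          rw [div_eq_mul_inv, show c * t⁻¹ * (t * P.bobMass b u v.1 v.2) =
            (t * t⁻¹) * (c * P.bobMass b u v.1 v.2) by ring, ENNReal.mul_inv_cancel ht ht', one_mul]
  rw [Fintype.sum_bool, mul_assoc, two_mul]
  exact add_le_add (h true) (h false)

/-- Eve's posterior law of the secrets is nearly uniform, so that the chosen string is rarely an
unusually likely value of Bob's estimate. -/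
lemma toOuterMeasure_likelyEstimates_le [Countable Z] (P : Protocol Y n m)
    (W : Bool → PMF (Y × Z)) (b : Y → Z → ℝ≥0∞) {t c : ℝ≥0∞} (ht : t ≠ 0) (ht' : t ≠ ∞) {δ : ℝ}
    (h0 : 0 < δ) (h1 : δ ≤ 1) :
    (P.law W).toOuterMeasure {ω | (ω.secrets, ω.viewE) ∈ P.likelyEstimates b t c} ≤
      (2 ^ m)⁻¹ * (c / t) + (ENNReal.ofReal δ + P.leakToEve W / ENNReal.ofReal δ) := by
  classical
  have := P.countable_msg
  refine (toOuterMeasure_le_add_mutualInfo (P.law W) Execution.secrets Execution.viewE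
    (P.likelyEstimates b t c) h0 h1).trans ?_
  rw [leakToEve]
  gcongr
  rw [(Equiv.prodComm _ _).symm.tsum_eq _ |>.symm, ENNReal.tsum_prod']
  calc _ = ∑' v, (Fintype.card (Strings m × Bool) : ℝ≥0∞)⁻¹ *
        (∑ d, (P.likelyEstimates b t c).indicator (fun _ => 1) (d, v)) *
          (P.law W).map Execution.viewE v := by
        refine tsum_congr fun v => ?_
        rw [tsum_fintype, Finset.mul_sum, Finset.sum_mul]
        refine Finset.sum_congr rfl fun d _ => ?_
        simp only [Equiv.prodComm_symm, Equiv.prodComm_apply, Prod.swap_prod_mk, Set.indicator,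
          P.map_secrets_law, PMF.uniformOfFintype_apply]
        split_ifs <;> simp
    _ ≤ ∑' v, (Fintype.card (Strings m × Bool) : ℝ≥0∞)⁻¹ * (2 * 2 ^ m * (c / t)) *
          (P.law W).map Execution.viewE v := by
        refine ENNReal.tsum_le_tsum fun v => ?_
        gcongr
        exact P.sum_likelyEstimates_le b ht ht' v
    _ = _ := by
        rw [ENNReal.tsum_mul_left, PMF.tsum_coe, mul_one]
        have hcard : (Fintype.card (Strings m × Bool) : ℝ≥0∞) = 2 ^ m * (2 * 2 ^ m) := by
          simp; ring
        rw [hcard, ENNReal.mul_inv (by simp) (by simp), mul_assoc, ← mul_assoc (2 * 2 ^ m)⁻¹,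
          ENNReal.inv_mul_cancel (by simp) (by finiteness), one_mul]

/-- Apart from the likely estimates, Bob's estimate is as good as a guess of Eve. -/
lemma toOuterMeasure_unlikelyEstimates_le (P : Protocol Y n m) (W W' : Bool → PMF (Y × Z))
    (a : Bool → Z → ℝ≥0∞) (b : Y → Z → ℝ≥0∞) (hab : ∀ x y z, W' x (y, z) = a x z * b y z)
    (T : Y × Z → Bool) (hW : ∀ x yz, W x yz ≤ (if T yz then 1 * 2 else 1) * W' x yz) (N : ℕ)
    (t : ℝ≥0∞) :
    (P.law W).toOuterMeasure {ω | P.estimate ω.choice ω.ys ω.transcript = ω.chosen ∧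
        (ω.ys.zip ω.zs).countP T ≤ N ∧
        (ω.secrets, ω.viewE) ∉ P.likelyEstimates b t (2 ^ N)} ≤ t := by
  classical
  rw [PMF.toOuterMeasure_apply, ← (executionEquivOutputs P.Msg Y Z m).tsum_eq, ENNReal.tsum_prod']
  -- With all but Bob's outputs fixed, the scrambled channel separates `ys` from Alice's data.
  -- Outside `likelyEstimates` the fraction of Bob's mass leading to the correct string is at most
  -- `t / 2 ^ N`.
  have hle : ∀ r : (Strings m × Bool) × List Bool × List Z × List P.Msg,
      ∑' ys, Set.indicator {ω : Execution P.Msg Y Z m |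
        P.estimate ω.choice ω.ys ω.transcript = ω.chosen ∧ (ω.ys.zip ω.zs).countP T ≤ N ∧
        (ω.secrets, ω.viewE) ∉ P.likelyEstimates b t (2 ^ N)} (P.law W)
        (executionEquivOutputs P.Msg Y Z m (r, ys)) ≤
      t * ∑' ys, P.law W' (executionEquivOutputs P.Msg Y Z m (r, ys)) := by
    rintro ⟨⟨k, u⟩, xs, zs, f⟩
    simp only [executionEquivOutputs, Equiv.coe_fn_mk]
    set c₀ := (Fintype.card (Strings m × Bool) : ℝ≥0∞)⁻¹ *
      (P.aliceLik k P.schedule.reverse xs f * zipLik a xs zs) with hc₀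
    have hlaw : ∀ ys, P.law W' ⟨k, u, xs, ys, zs, f⟩ =
        c₀ * (zipLik b ys zs * P.bobLik u P.schedule.reverse ys f) := by
      intro ys
      rw [P.law_apply, chanLik_eq_zipLik W' a b hab, hc₀]
      ring
    by_cases hD : ((k, u), (zs, f)) ∈ P.likelyEstimates b t (2 ^ N)
    · refine (le_of_eq (ENNReal.tsum_eq_zero.2 fun ys => ?_)).trans bot_le
      rw [Set.indicator_of_notMem]
      exact fun h => h.2.2 hD
    · calc _ ≤ ∑' ys, 2 ^ N * c₀ * (if P.estimate u ys f = k u then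
            zipLik b ys zs * P.bobLik u P.schedule.reverse ys f else 0) := by
            refine ENNReal.tsum_le_tsum fun ys => ?_
            refine Set.indicator_apply_le' (fun hω => ?_) (fun _ => bot_le)
            rw [if_pos (show P.estimate u ys f = k u from hω.1), mul_assoc, ← hlaw]
            -- At most `N` positions cost a factor 2, so returning to the true channel costs at most
            -- `2 ^ N`.
            refine (P.law_le W W' _ hW _).trans ?_
            gcongr
            rw [prod_map_ite, one_pow, one_mul]
            exact pow_le_pow_right₀ one_le_two hω.2.1
        _ = 2 ^ N * c₀ * P.estimateMass b u zs f (k u) := by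
            rw [ENNReal.tsum_mul_left, estimateMass]
        _ = c₀ * (2 ^ N * P.estimateMass b u zs f (k u)) := by ring
        _ ≤ c₀ * (t * P.bobMass b u zs f) := by
            gcongr c₀ * ?_
            exact not_lt.1 hD
        _ = _ := by
            simp only [hlaw]
            rw [ENNReal.tsum_mul_left, bobMass]
            ring
  refine (ENNReal.tsum_le_tsum hle).trans (le_of_eq ?_)
  rw [ENNReal.tsum_mul_left, ← ENNReal.tsum_prod' (f := fun s => P.law W' (executionEquivOutputs P.Msg Y Z m s)),
    (executionEquivOutputs P.Msg Y Z m).tsum_eq (fun ω => P.law W' ω), PMF.tsum_coe, mul_one]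

/-- Four events cover everything: a decoding error, too many positions known to Bob alone, a likely
estimate (rare because Eve's posterior is nearly uniform), and a correct but unlikely estimate, of
probability at most `t`. -/
lemma one_le_of_secret [Countable Z] (P : Protocol Y n m) (W W' : Bool → PMF (Y × Z))
    (a : Bool → Z → ℝ≥0∞) (b : Y → Z → ℝ≥0∞) (hab : ∀ x y z, W' x (y, z) = a x z * b y z)
    (T : Y × Z → Bool) (hW : ∀ x yz, W x yz ≤ (if T yz then 1 * 2 else 1) * W' x yz) (N : ℕ)
    {t : ℝ≥0∞} (ht : t ≠ 0) (ht' : t ≠ ∞) {δ : ℝ} (h0 : 0 < δ) (h1 : δ ≤ 1) :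
    1 ≤ P.errorProb W + ((P.law W).toOuterMeasure {ω | N + 1 ≤ (ω.ys.zip ω.zs).countP T} +
      (((2 ^ m)⁻¹ * (2 ^ N / t) + (ENNReal.ofReal δ + P.leakToEve W / ENNReal.ofReal δ)) + t)) := by
  have huniv : (P.law W).toOuterMeasure Set.univ = 1 := by
    rw [PMF.toOuterMeasure_apply, Set.indicator_univ, PMF.tsum_coe]
  rw [← huniv]
  refine (MeasureTheory.measure_mono (t := {ω | P.estimate ω.choice ω.ys ω.transcript ≠ ω.chosen} ∪
    ({ω | N + 1 ≤ (ω.ys.zip ω.zs).countP T} ∪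
      ({ω | (ω.secrets, ω.viewE) ∈ P.likelyEstimates b t (2 ^ N)} ∪
      {ω | P.estimate ω.choice ω.ys ω.transcript = ω.chosen ∧ (ω.ys.zip ω.zs).countP T ≤ N ∧
        (ω.secrets, ω.viewE) ∉ P.likelyEstimates b t (2 ^ N)}))) ?_).trans
    ((MeasureTheory.measure_union_le _ _).trans ?_)
  · intro ω _
    by_cases h : P.estimate ω.choice ω.ys ω.transcript = ω.chosen
    · by_cases h2 : N + 1 ≤ (ω.ys.zip ω.zs).countP T
      · exact Or.inr (Or.inl h2)
      · by_cases h3 : (ω.secrets, ω.viewE) ∈ P.likelyEstimates b t (2 ^ N)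
        · exact Or.inr (Or.inr (Or.inl h3))
        · exact Or.inr (Or.inr (Or.inr ⟨h, by omega, h3⟩))
    · exact Or.inl h
  · rw [errorProb]
    gcongr
    refine (MeasureTheory.measure_union_le _ _).trans ?_
    gcongr
    refine (MeasureTheory.measure_union_le _ _).trans ?_
    gcongr
    · exact P.toOuterMeasure_likelyEstimates_le W b ht ht' h0 h1
    · exact P.toOuterMeasure_unlikelyEstimates_le W W' a b hab T hW N t

end Protocol

end KeyBound

/-! ### The converse bounds for the degraded erasure channel -/

section Converse

variable (ε₁ ε₂ : unitInterval)

/-- The factor of the input in the transition probabilities of `scrambledBEC`. -/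
def scrambledInput (x : Bool) (z : Option Bool) : ℝ≥0∞ :=
  if z = none ∨ z = some x then 1 else 0

/-- The factor of Bob's output in the transition probabilities of `scrambledBEC`. -/
def scrambledOutput (y z : Option Bool) : ℝ≥0∞ :=
  if z = none then
    if y = none then ENNReal.ofReal ε₁ else ENNReal.ofReal (1 - ε₁) * ENNReal.ofReal ε₂ / 2
  else if y = z then ENNReal.ofReal (1 - ε₁) * ENNReal.ofReal (1 - ε₂) else 0

lemma ofReal_add_ofReal_one_sub (ε : unitInterval) :
    ENNReal.ofReal (ε : ℝ) + ENNReal.ofReal (1 - ε) = 1 := by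
  rw [← ENNReal.ofReal_add ε.2.1 (by linarith [ε.2.2])]
  simp

/-- The degraded erasure channel with Bob's output replaced by a random bit wherever Bob but not
Eve has received the input; here Bob's output is independent of the input given Eve's output. -/
def scrambledBEC (x : Bool) : PMF (Option Bool × Option Bool) :=
  PMF.ofFintype (fun yz => scrambledInput x yz.2 * scrambledOutput ε₁ ε₂ yz.1 yz.2) <| by
    have h : ENNReal.ofReal (ε₁ : ℝ) + (ENNReal.ofReal (1 - ε₁) * ENNReal.ofReal ε₂ +
        ENNReal.ofReal (1 - ε₁) * ENNReal.ofReal (1 - ε₂)) = 1 := by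
      rw [← mul_add, ofReal_add_ofReal_one_sub, mul_one, ofReal_add_ofReal_one_sub]
    rw [Fintype.sum_prod_type]
    rw [← ENNReal.add_halves (ENNReal.ofReal (1 - ε₁) * ENNReal.ofReal ε₂)] at h
    rw [← h]
    simp only [Fintype.sum_option, scrambledInput, scrambledOutput]
    generalize ENNReal.ofReal (1 - ε₁) * ENNReal.ofReal ε₂ / 2 = c
    cases x <;> simp <;> ring

/-- The fresh coin agrees with the true bit with probability `1 / 2`, so only positions received by
Bob but not by Eve cost a factor 2. The form `1 * 2` matches `prod_map_ite` with base 1. -/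
lemma degradedBEC_le_scrambledBEC (x : Bool) (yz : Option Bool × Option Bool) :
    degradedBEC ε₁ ε₂ x yz ≤
      (if (yz.1.isSome && yz.2.isNone) then 1 * 2 else 1) * scrambledBEC ε₁ ε₂ x yz := by
  have h2 : ∀ c : ℝ≥0∞, 2 * (c / 2) = c := fun c => ENNReal.mul_div_cancel (by simp) (by simp)
  change _ ≤ _ * (scrambledInput x yz.2 * scrambledOutput ε₁ ε₂ yz.1 yz.2)
  rw [degradedBEC_apply]
  obtain ⟨y, z⟩ := yz
  rcases y with _ | y <;> rcases z with _ | z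
  · simp [bec_apply, becStage, scrambledInput, scrambledOutput]
  · simp [becStage]
  · simp only [bec_apply, becStage, scrambledInput, scrambledOutput]
    by_cases h : y = x <;> simp [h, h2]
  · simp only [bec_apply, becStage, scrambledInput, scrambledOutput]
    by_cases h : y = x
    · subst h
      by_cases h' : y = z
      · subst h'; simp
      · simp [h', Ne.symm h']
    · simp [h]

lemma degradedBEC_ne_zero (x : Bool) (yz : Option Bool × Option Bool)
    (h : degradedBEC ε₁ ε₂ x yz ≠ 0) : yz.1 = none ∨ yz.1 = some x := by
  rw [degradedBEC_apply, bec_apply] at h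
  by_contra hne
  push Not at hne
  simp [hne.1, hne.2] at h

/-- If the rate exceeds `ν`, then `2 ^ ⌊ν n⌋` is negligible compared to the number of strings. -/
lemma tendsto_two_pow_floor_mul_inv {m : ℕ → ℕ} {R : ℝ≥0} {ν : ℝ} (h0 : 0 ≤ ν) (hν : ν < R)
    (hm : Tendsto (fun n => (m n : ℝ≥0) / (n : ℝ≥0)) atTop (𝓝 R)) :
    Tendsto (fun n : ℕ => (2 : ℝ≥0∞) ^ ⌊ν * n⌋₊ * (2 ^ m n)⁻¹) atTop (𝓝 0) := by
  -- The gap `μ - ν` supplies a geometric decay, as eventually `m n > μ n`.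
  obtain ⟨μ, hνμ, hμR⟩ := exists_between hν
  have hm' : Tendsto (fun n => (m n : ℝ) / (n : ℝ)) atTop (𝓝 R) := by
    have := (NNReal.tendsto_coe (f := atTop)).2 hm
    simpa using this
  have hlin : Tendsto (fun n : ℕ => (μ - ν) * (n : ℝ)) atTop atTop :=
    tendsto_natCast_atTop_atTop.const_mul_atTop (by linarith)
  have hfl : Tendsto (fun n : ℕ => ⌊(μ - ν) * (n : ℝ)⌋₊) atTop atTop :=
    tendsto_nat_floor_atTop.comp hlin
  have hpow : Tendsto (fun n : ℕ => (2⁻¹ : ℝ≥0∞) ^ ⌊(μ - ν) * (n : ℝ)⌋₊) atTop (𝓝 0) :=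
    (ENNReal.tendsto_pow_atTop_nhds_zero_of_lt_one (by simp)).comp hfl
  refine tendsto_of_tendsto_of_tendsto_of_le_of_le' tendsto_const_nhds hpow
    (Eventually.of_forall fun _ => bot_le) ?_
  filter_upwards [hm'.eventually (eventually_gt_nhds hμR), eventually_gt_atTop 0] with n hn hn0
  have hn0' : (0 : ℝ) < n := by exact_mod_cast hn0
  rw [lt_div_iff₀ hn0'] at hn
  have hle : ⌊ν * n⌋₊ + ⌊(μ - ν) * n⌋₊ ≤ m n := by
    have h1 := Nat.floor_le (mul_nonneg h0 hn0'.le)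
    have h2 := Nat.floor_le (mul_nonneg (by linarith : 0 ≤ μ - ν) hn0'.le)
    have : ((⌊ν * n⌋₊ + ⌊(μ - ν) * n⌋₊ : ℕ) : ℝ) ≤ m n := by push_cast; nlinarith
    exact_mod_cast this
  rw [← div_eq_mul_inv]
  refine ENNReal.div_le_of_le_mul ?_
  calc (2 : ℝ≥0∞) ^ ⌊ν * n⌋₊ = 2⁻¹ ^ ⌊(μ - ν) * (n : ℝ)⌋₊ * (2 ^ ⌊(μ - ν) * (n : ℝ)⌋₊ *
        2 ^ ⌊ν * n⌋₊) := by
        rw [← mul_assoc, ← mul_pow, ENNReal.inv_mul_cancel (by simp) (by simp), one_pow, one_mul]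
    _ ≤ _ := by
        gcongr
        rw [← pow_add]
        exact pow_le_pow_right₀ one_le_two (by omega)

variable {ε₁ ε₂} {R : ℝ≥0}

lemma tendsto_add_div_ofReal {l : ℕ → ℝ≥0∞} (hl : Tendsto l atTop (𝓝 0)) {δ : ℝ} (h0 : 0 < δ) :
    Tendsto (fun n => ENNReal.ofReal δ + l n / ENNReal.ofReal δ) atTop (𝓝 (ENNReal.ofReal δ)) := by
  have h := ENNReal.Tendsto.div_const (b := ENNReal.ofReal δ) hl (Or.inr (by simpa using h0))
  simpa using tendsto_const_nhds.add h

lemma le_erasure_of_achievable (h : Achievable (degradedBEC ε₁ ε₂) R) : (R : ℝ) ≤ ε₁ := by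
  by_contra! hlt
  obtain ⟨m, P, -, hm, herr, hB, hA, -⟩ := h
  obtain ⟨ν, hν₁, hν₂⟩ := exists_between hlt
  obtain ⟨q, hq, htail⟩ := exists_tail_bound (degradedBEC ε₁ ε₂) (fun yz => yz.1.isNone) ε₁.2.1
    ε₁.2.2 (tsum_degradedBEC_erased ε₁ ε₂) hν₁
  -- The limiting bound is `δ + 2 δ = 3 / 16`, less than `1 / 2`.
  have hδ : (0 : ℝ) < 1 / 16 := by norm_num
  have hlim := herr.add (((ENNReal.tendsto_pow_atTop_nhds_zero_of_lt_one hq).add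
    ((tendsto_two_pow_floor_mul_inv (ε₁.2.1.trans hν₁.le) hν₂ hm).add
      (tendsto_add_div_ofReal hB hδ))).add
    (ENNReal.Tendsto.const_mul (a := 2) (tendsto_add_div_ofReal hA hδ) (Or.inr (by simp))))
  have hle := ge_of_tendsto' hlim (b := 2⁻¹) fun n => by
    refine ((P n).half_le_of_erasures _ (degradedBEC_ne_zero ε₁ ε₂) ⌊ν * n⌋₊ hδ (by norm_num)).trans ?_
    gcongr
    exact htail n (m n) (P n) _ (by exact_mod_cast (Nat.lt_floor_add_one _).le)
  rw [show (2 : ℝ≥0∞) = ENNReal.ofReal 2 by simp, ← ENNReal.ofReal_inv_of_pos two_pos,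
    ← ENNReal.ofReal_mul two_pos.le, zero_add, zero_add, zero_add,
    ← ENNReal.ofReal_add (by norm_num) (by norm_num), ENNReal.ofReal_le_ofReal_iff (by norm_num)] at hle
  norm_num at hle

lemma le_secret_of_achievable (h : Achievable (degradedBEC ε₁ ε₂) R) :
    (R : ℝ) ≤ ε₂ * (1 - ε₁) := by
  by_contra! hlt
  have hc0 : (0 : ℝ) ≤ ε₂ * (1 - ε₁) := mul_nonneg ε₂.2.1 (by linarith [ε₁.2.2])
  have hc1 : (ε₂ : ℝ) * (1 - ε₁) ≤ 1 :=
    mul_le_one₀ ε₂.2.2 (by linarith [ε₁.2.2]) (by linarith [ε₁.2.1])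
  obtain ⟨m, P, -, hm, herr, -, -, hE⟩ := h
  obtain ⟨ν, hν₁, hν₂⟩ := exists_between hlt
  obtain ⟨q, hq, htail⟩ := exists_tail_bound (degradedBEC ε₁ ε₂)
    (fun yz => yz.1.isSome && yz.2.isNone) hc0 hc1 (tsum_degradedBEC_secret ε₁ ε₂) hν₁
  -- Together with `t = 1 / 2` the limiting bound is `1 / 16 + 1 / 2`, less than 1.
  have hδ : (0 : ℝ) < 1 / 16 := by norm_num
  have ht0 : (2⁻¹ : ℝ≥0∞) ≠ 0 := by simp
  have hkey := ENNReal.Tendsto.div_const (b := 2⁻¹)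
    (tendsto_two_pow_floor_mul_inv (hc0.trans hν₁.le) hν₂ hm) (Or.inr ht0)
  have hlim := herr.add ((ENNReal.tendsto_pow_atTop_nhds_zero_of_lt_one hq).add
    ((hkey.add (tendsto_add_div_ofReal hE hδ)).add (tendsto_const_nhds (x := 2⁻¹))))
  have hle := ge_of_tendsto' hlim (b := 1) fun n => by
    refine ((P n).one_le_of_secret _ (scrambledBEC ε₁ ε₂) scrambledInput (scrambledOutput ε₁ ε₂)
      (fun _ _ _ => rfl) _ (degradedBEC_le_scrambledBEC ε₁ ε₂) ⌊ν * n⌋₊ ht0 (by simp) hδ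
      (by norm_num)).trans ?_
    gcongr
    · exact htail n (m n) (P n) _ (by exact_mod_cast (Nat.lt_floor_add_one _).le)
    · rw [div_eq_mul_inv, div_eq_mul_inv, ← mul_assoc, mul_comm (2 ^ m n)⁻¹]
  rw [ENNReal.zero_div, zero_add, zero_add, zero_add, show (2 : ℝ≥0∞) = ENNReal.ofReal 2 by simp,
    ← ENNReal.ofReal_inv_of_pos two_pos, ← ENNReal.ofReal_add (by norm_num) (by norm_num),
    ENNReal.one_le_ofReal] at hle
  norm_num at hle

/-- The upper bound on the oblivious transfer capacity. -/
lemma otCapacity_degradedBEC_le (ε₁ ε₂ : unitInterval) :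
    otCapacity (degradedBEC ε₁ ε₂) ≤ ENNReal.ofReal (min ((ε₂ : ℝ) * (1 - ε₁)) ε₁) := by
  refine iSup₂_le fun R hR => ?_
  rw [← ENNReal.ofReal_coe_nnreal]
  exact ENNReal.ofReal_le_ofReal (le_min (le_secret_of_achievable hR) (le_erasure_of_achievable hR))

end Converse

/-! ### Independent sequences -/

section Sequences

/-- The law of a pair whose second component is drawn given the first one. -/
def dprod {α β : Type} (p : PMF α) (q : α → PMF β) : PMF (α × β) :=
  p.bind fun a => (q a).map (Prod.mk a)

lemma dprod_apply {α β : Type} (p : PMF α) (q : α → PMF β) (c : α × β) :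
    dprod p q c = p c.1 * q c.1 c.2 := by
  classical
  obtain ⟨a, b⟩ := c
  rw [dprod, PMF.bind_apply, tsum_eq_single a]
  · rw [PMF.map_apply, tsum_eq_single b]
    · simp
    · intro b' hb'; simp [hb'.symm]
  · intro a' ha'
    rw [PMF.map_apply]
    simp [ha'.symm]

/-- The law of `n` independent random variables with law `p`. -/
def iidSeq {α : Type} (p : PMF α) : (n : ℕ) → PMF (Fin n → α)
  | 0 => PMF.pure Fin.elim0
  | n + 1 => p.bind fun a => (iidSeq p n).map fun w => Fin.snoc (α := fun _ => α) w a

lemma iidSeq_apply {α : Type} (p : PMF α) (n : ℕ) (w : Fin n → α) :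
    iidSeq p n w = ∏ i, p (w i) := by
  classical
  induction n with
  | zero => simp [iidSeq, Subsingleton.elim w Fin.elim0]
  | succ n ih =>
    rw [iidSeq, PMF.bind_apply, tsum_eq_single (w (Fin.last n)), PMF.map_apply,
      tsum_eq_single (Fin.init w)]
    · rw [if_pos (Fin.snoc_init_self w).symm, ih, Fin.prod_univ_castSucc, mul_comm]
      rfl
    · intro v hv
      rw [if_neg]
      rintro h
      apply hv
      rw [h, Fin.init_snoc]
    · intro a ha
      rw [PMF.map_apply]
      refine mul_eq_zero_of_right _ (ENNReal.tsum_eq_zero.2 fun v => if_neg ?_)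
      rintro h
      apply ha
      rw [h, Fin.snoc_last]

/-- A coin that shows `true` with probability `ε`. -/
def coin (ε : unitInterval) : PMF Bool :=
  PMF.ofFintype (fun b => if b then ENNReal.ofReal ε else ENNReal.ofReal (1 - ε)) <| by
    simpa using ofReal_add_ofReal_one_sub ε

lemma getD_ofFn {α : Type} {n : ℕ} (w : Fin n → α) (c : α) (i : Fin n) :
    (List.ofFn w).getD i c = w i := by
  simp [List.getD_eq_getElem?_getD]

end Sequences

/-! ### A protocol for the degraded erasure channel -/

section Scheme

variable {n m s : ℕ}

/-- Bits as elements of the field with two elements. -/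
def toZMod (b : Bool) : ZMod 2 := if b then 1 else 0

/-- Elements of the field with two elements as bits. -/
def ofZMod (z : ZMod 2) : Bool := decide (z = 1)

@[simp] lemma ofZMod_toZMod : ∀ b, ofZMod (toZMod b) = b := by decide
@[simp] lemma toZMod_ofZMod : ∀ z, toZMod (ofZMod z) = z := by decide
lemma toZMod_xor : ∀ a b, toZMod (a ^^ b) = toZMod a + toZMod b := by decide
lemma ofZMod_add : ∀ a b, ofZMod (a + b) = (ofZMod a ^^ ofZMod b) := by decide

/-- The roles of channel uses: two blocks that hide one string each, and a block from which a
secret key is extracted. -/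
abbrev Slot (m s : ℕ) : Type := (Bool × Fin m) ⊕ Fin s

/-- An assignment of channel uses to roles. -/
abbrev Labeling (n m s : ℕ) : Type := Slot m s ↪ Fin n

/-- A linear hash function that extracts a secret key: one bit for the order of the blocks, and
one-time pads for both strings. -/
abbrev Seed (m s : ℕ) : Type := Matrix (Option (Bool × Fin m)) (Fin s) (ZMod 2)

/-- The labelings for which Bob has received the block `q.2` and the key block, whereas the other
block has been erased. -/
def ValidLabeling (a : Fin n → Bool) (q : Labeling n m s × Bool) : Prop :=
  (∀ j, a (q.1 (.inl (q.2, j))) = false) ∧ (∀ j, a (q.1 (.inl (!q.2, j))) = true) ∧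
    ∀ j, a (q.1 (.inr j)) = false

open Classical in
/-- The valid labelings as a finite set. -/
def validLabelings (m s : ℕ) (a : Fin n → Bool) : Finset (Labeling n m s × Bool) :=
  Finset.univ.filter (ValidLabeling a)

open Classical in
/-- A uniformly chosen valid labeling, if there is one. -/
def selection (m s : ℕ) (a : Fin n → Bool) : PMF (Option (Labeling n m s × Bool)) :=
  if h : (validLabelings m s a).Nonempty then
    (PMF.uniformOfFinset (validLabelings m s a) h).map some
  else PMF.pure none

open Classical in
lemma selection_some (a : Fin n → Bool) (q : Labeling n m s × Bool) :
    selection m s a (some q) =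
      if ValidLabeling a q then ((validLabelings m s a).card : ℝ≥0∞)⁻¹ else 0 := by
  rw [selection]
  split_ifs with h hq hq
  · rw [PMF.map_apply, tsum_eq_single q (by intro q' hq'; simp [hq'.symm]), if_pos rfl,
      PMF.uniformOfFinset_apply, if_pos (by simpa [validLabelings] using hq)]
  · rw [PMF.map_apply, tsum_eq_single q (by intro q' hq'; simp [hq'.symm]), if_pos rfl,
      PMF.uniformOfFinset_apply, if_neg (by simpa [validLabelings] using hq)]
  · exact absurd ⟨q, by simpa [validLabelings] using hq⟩ h
  · simp [PMF.pure_apply]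

open Classical in
lemma selection_none (a : Fin n → Bool) :
    selection m s a none = if (validLabelings m s a).Nonempty then 0 else 1 := by
  rw [selection]
  split_ifs with h
  · simp [PMF.map_apply]
  · simp [PMF.pure_apply]

/-- The secret key extracted from the key block. -/
def secretKey (M : Seed m s) (τ : Labeling n m s) (x : Fin n → Bool) :
    Option (Bool × Fin m) → ZMod 2 :=
  M.mulVec fun j => toZMod (x (τ (.inr j)))

/-- The encryption of the order of the blocks. -/
def orderBit (M : Seed m s) (τ : Labeling n m s) (x : Fin n → Bool) (c : Bool) : Bool :=
  c ^^ ofZMod (secretKey M τ x none)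

/-- The encryption of both strings; `c` is the order of the blocks. -/
def ciphertext (k : Strings m) (M : Seed m s) (τ : Labeling n m s) (x : Fin n → Bool) (c : Bool) :
    Bool → Fin m → ZMod 2 :=
  fun i j => toZMod (k i j) + toZMod (x (τ (.inl (i ^^ c, j)))) + secretKey M τ x (some (i, j))

/-- Bob's decryption of the string of index `u`. -/
def decrypt (C : Bool → Fin m → ZMod 2) (M : Seed m s) (τ : Labeling n m s) (x : Fin n → Bool)
    (c u : Bool) : Fin m → Bool :=
  fun j => ofZMod (C u j + toZMod (x (τ (.inl (u ^^ c, j)))) + secretKey M τ x (some (u, j)))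

/-- The sequence of bits in a list of channel outputs, with erased bits set to `false`. -/
def received (n : ℕ) (ys : List (Option Bool)) : Fin n → Bool := fun i => (ys.getD i none).getD false

/-- The erasure pattern of a list of channel outputs. -/
def erasures (n : ℕ) (ys : List (Option Bool)) : Fin n → Bool := fun i => (ys.getD i none).isNone

/-- The public messages: a seed and a labeling with the encrypted order of the blocks, from Bob; or
the encrypted strings, from Alice. -/
abbrev OTMsg (n m s : ℕ) : Type :=
  (Seed m s × Option (Labeling n m s × Bool)) ⊕ (Bool → Fin m → ZMod 2)

/-- Bob's message for given random choices. -/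
def bobAnswer (u : Bool) (x : Fin n → Bool) (M : Seed m s) (o : Option (Labeling n m s × Bool)) :
    OTMsg n m s :=
  .inl (M, o.map fun q => (q.1, orderBit M q.1 x (u ^^ q.2)))

/-- Alice's answer to the message of Bob. -/
def aliceAnswer (k : Strings m) (x : Fin n → Bool) : List (OTMsg n m s) → OTMsg n m s
  -- XOR with the same key bit undoes itself, so `orderBit` also decrypts `d`.
  | .inl (M, some (τ, d)) :: _ => .inr (ciphertext k M τ x (orderBit M τ x d))
  | _ => .inr 0

/-- Bob's estimate. -/
def bobEstimate (u : Bool) (x : Fin n → Bool) : List (OTMsg n m s) → Fin m → Bool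
  | [.inr C, .inl (M, some (τ, d))] => decrypt C M τ x (orderBit M τ x d) u
  | _ => fun _ => false

/-- The protocol that achieves the lower bound: Alice sends random bits; Bob chooses one block of
bits that he knows, one that he does not know, and some further bits that he knows; the latter give
a key by which the order of the blocks and the strings are hidden from Eve. -/
def otProtocol (n m s : ℕ) : Protocol (Option Bool) n m where
  Msg := OTMsg n m s
  countable_msg := inferInstance
  schedule := List.replicate n .channelUse ++ [.bobMessage, .aliceMessage]
  count_channelUse := by simp
  aliceMsg k xs f := PMF.pure (aliceAnswer k (fun i : Fin n => xs.getD i false) f)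
  bobMsg u ys _ := (PMF.uniformOfFintype (Seed m s)).bind fun M =>
    (selection m s (erasures n ys)).map (bobAnswer u (received n ys) M)
  input _ _ _ := PMF.uniformOfFintype Bool
  estimate u ys f := bobEstimate u (received n ys) f

variable (ε₁ ε₂ : unitInterval)

/-- Bob's output for the input `x` and the erasure `a`. -/
def bobOutput (x a : Bool) : Option Bool := if a then none else some x

/-- Eve's output for the input `x`, Bob's erasure `a` and her additional erasure `b`. -/
def eveOutput (x a b : Bool) : Option Bool := if a || b then none else some x

/-- Eve's additional coin is tossed even when Bob's symbol is already erased, where it has no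
effect; thus both erasure patterns are independent of each other and of the inputs. -/
lemma degradedBEC_eq_map (x : Bool) :
    degradedBEC ε₁ ε₂ x = (coin ε₁).bind fun a => (coin ε₂).map fun b =>
      (bobOutput x a, eveOutput x a b) := by
  ext ⟨y, z⟩
  have h : (0 : ℝ) ≤ 1 - ε₁ := by linarith [ε₁.2.2]
  have h2 := ofReal_add_ofReal_one_sub ε₂
  rw [degradedBEC_apply, PMF.bind_apply, tsum_bool]
  simp only [PMF.map_apply, tsum_bool, coin, PMF.ofFintype_apply, bobOutput, eveOutput, bec_apply]
  cases x <;> rcases y with _ | _ | _ <;> rcases z with _ | _ | _ <;>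
    simp [becStage, bec_apply, PMF.pure_apply, add_comm (ENNReal.ofReal (1 - (ε₂ : ℝ))), h2]

/-- Runs of channel uses with independent uniform inputs. -/
lemma run_replicate_channelUse (P : Protocol (Option Bool) n m)
    (hP : ∀ k xs f, P.input k xs f = PMF.uniformOfFintype Bool) (l : ℕ)
    (ω : Execution P.Msg (Option Bool) (Option Bool) m) :
    P.run (degradedBEC ε₁ ε₂) (List.replicate l .channelUse) ω =
      (iidSeq (PMF.uniformOfFintype Bool) l).bind fun x => (iidSeq (coin ε₁) l).bind fun a =>
        (iidSeq (coin ε₂) l).map fun b =>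
          ⟨ω.strings, ω.choice, List.ofFn x ++ ω.xs,
            (List.ofFn fun i => bobOutput (x i) (a i)) ++ ω.ys,
            (List.ofFn fun i => eveOutput (x i) (a i) (b i)) ++ ω.zs, ω.transcript⟩ := by
  induction l generalizing ω with
  | zero => simp [Protocol.run, iidSeq, PMF.pure_map]
  | succ l ih =>
    rw [List.replicate_succ, Protocol.run]
    simp only [Protocol.step, hP, degradedBEC_eq_map, iidSeq, PMF.bind_bind, PMF.map_bind,
      PMF.bind_map, PMF.map_comp]
    congr 1
    funext x₀
    simp only [Function.comp_def, ih]
    refine (congrArg _ (funext fun a₀ => PMF.bind_comm _ _ _)).trans ?_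
    rw [PMF.bind_comm]
    congr 1
    funext x
    congr 1
    funext a₀
    rw [PMF.bind_comm]
    congr 1
    funext a
    congr 1
    funext b₀
    congr 1
    funext b
    -- `iidSeq` appends its first draw at the end, in accordance with lists whose newest entry comes
    -- first.
    simp only [List.ofFn_succ', List.concat_eq_append, Fin.snoc_castSucc, Fin.snoc_last,
      List.append_assoc, List.singleton_append]

/-- The random choices of an execution: the secrets, the channel inputs, Bob's erasures, the choice
of the labeling, Eve's additional erasures, and the seed. -/
abbrev Sample (n m s : ℕ) : Type :=
  (Strings m × Bool) × (Fin n → Bool) × (Fin n → Bool) × Option (Labeling n m s × Bool) ×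
    (Fin n → Bool) × Seed m s

/-- The law of the random choices. -/
def sampleLaw (n m s : ℕ) : PMF (Sample n m s) :=
  dprod (PMF.uniformOfFintype _) fun _ => dprod (iidSeq (PMF.uniformOfFintype Bool) n) fun _ =>
    dprod (iidSeq (coin ε₁) n) fun a => dprod (selection m s a) fun _ =>
      dprod (iidSeq (coin ε₂) n) fun _ => PMF.uniformOfFintype _

/-- The transcript that results from given random choices; `x` are the channel inputs and `y` the
bits received by Bob. -/
def transcriptOf (k : Strings m) (u : Bool) (x y : Fin n → Bool) (M : Seed m s)
    (o : Option (Labeling n m s × Bool)) : List (OTMsg n m s) :=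
  [aliceAnswer k x [bobAnswer u y M o], bobAnswer u y M o]

/-- The bits received by Bob, with erased bits set to `false`. -/
def maskedBits (x a : Fin n → Bool) : Fin n → Bool := fun i => (bobOutput (x i) (a i)).getD false

/-- The execution that results from given random choices. -/
def executionOf (ω : Sample n m s) :
    Execution (OTMsg n m s) (Option Bool) (Option Bool) m :=
  match ω with
  | ((k, u), x, a, o, b, M) =>
    ⟨k, u, List.ofFn x, List.ofFn fun i => bobOutput (x i) (a i),
      List.ofFn fun i => eveOutput (x i) (a i) (b i), transcriptOf k u x (maskedBits x a) M o⟩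

lemma erasures_ofFn (x a : Fin n → Bool) :
    erasures n (List.ofFn fun i => bobOutput (x i) (a i)) = a := by
  funext i
  rw [erasures, getD_ofFn, bobOutput]
  cases a i <;> rfl

lemma received_ofFn (x a : Fin n → Bool) :
    received n (List.ofFn fun i => bobOutput (x i) (a i)) = maskedBits x a := by
  funext i
  rw [received, getD_ofFn, maskedBits]

lemma run_messages_otProtocol (n m s : ℕ)
    (ω : Execution (OTMsg n m s) (Option Bool) (Option Bool) m) :
    (otProtocol n m s).run (degradedBEC ε₁ ε₂) [.bobMessage, .aliceMessage] ω =
      (PMF.uniformOfFintype (Seed m s)).bind fun M => (selection m s (erasures n ω.ys)).map fun o =>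
        ⟨ω.strings, ω.choice, ω.xs, ω.ys, ω.zs,
          aliceAnswer ω.strings (fun i : Fin n => ω.xs.getD i false)
            (bobAnswer ω.choice (received n ω.ys) M o :: ω.transcript) ::
            bobAnswer ω.choice (received n ω.ys) M o :: ω.transcript⟩ := by
  have h : ∀ ω' : Execution (OTMsg n m s) (Option Bool) (Option Bool) m,
      (otProtocol n m s).run (degradedBEC ε₁ ε₂) [.aliceMessage] ω' =
      PMF.pure ⟨ω'.strings, ω'.choice, ω'.xs, ω'.ys, ω'.zs,
        aliceAnswer ω'.strings (fun i : Fin n => ω'.xs.getD i false) ω'.transcript ::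
          ω'.transcript⟩ := by
    intro ω'
    exact (PMF.bind_pure _).trans (PMF.pure_map _ _)
  refine (PMF.bind_map _ _ _).trans ?_
  refine (PMF.bind_bind _ _ _).trans ?_
  refine congrArg (PMF.bind _) (funext fun M => ?_)
  refine (PMF.bind_map _ _ _).trans ?_
  refine congrArg (PMF.bind _) (funext fun o => ?_)
  exact h _

/-- All randomness can be drawn in advance. In this order the labeling depends only on Bob's
erasures, so Eve's additional erasures and the seed remain independent of it. -/
lemma law_otProtocol (n m s : ℕ) :
    (otProtocol n m s).law (degradedBEC ε₁ ε₂) = (sampleLaw ε₁ ε₂ n m s).map executionOf := by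
  rw [Protocol.law, sampleLaw, dprod, PMF.map_bind]
  congr 1
  funext d
  obtain ⟨k, u⟩ := d
  change (otProtocol n m s).run _ (List.replicate n .channelUse ++ [.bobMessage, .aliceMessage]) _ = _
  rw [Protocol.run_append, run_replicate_channelUse ε₁ ε₂ _ (fun _ _ _ => rfl), PMF.map_comp,
    dprod, PMF.map_bind, PMF.bind_bind]
  congr 1
  funext x
  rw [PMF.map_comp, dprod, PMF.map_bind, PMF.bind_bind]
  congr 1
  funext a
  rw [PMF.bind_map]
  simp only [dprod, PMF.map_bind, PMF.map_comp]
  rw [PMF.bind_comm]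
  congr 1
  funext b
  refine (run_messages_otProtocol ε₁ ε₂ n m s _).trans ?_
  simp only [List.append_nil, erasures_ofFn, received_ofFn, getD_ofFn]
  exact PMF.bind_comm _ _ _

end Scheme

/-! ### Privacy of the protocol -/

section Privacy

/-- The tool for every privacy claim: with `F` the pair of secret and view, a `T` that changes the
secret and keeps the view shows that the posterior does not favour any value of the secret. -/
lemma map_apply_le_of_injective {Ω γ : Type} (p : PMF Ω) (F : Ω → γ) (T : Ω → Ω)
    (hT : Function.Injective T) (c c' : γ)
    (h : ∀ ω, p ω ≠ 0 → F ω = c → p ω ≤ p (T ω) ∧ F (T ω) = c') : p.map F c ≤ p.map F c' := by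
  classical
  rw [PMF.map_apply, PMF.map_apply]
  calc ∑' ω, (if c = F ω then p ω else 0)
      ≤ ∑' ω, (if c' = F (T ω) then p (T ω) else 0) := by
        refine ENNReal.tsum_le_tsum fun ω => ?_
        split_ifs with h1 h2 h2
        · by_cases h0 : p ω = 0
          · rw [h0]; exact bot_le
          · exact (h ω h0 h1.symm).1
        · by_cases h0 : p ω = 0
          · rw [h0]
          · exact absurd (h ω h0 h1.symm).2.symm h2
        · exact bot_le
        · exact le_rfl
    _ ≤ _ := ENNReal.tsum_comp_le_tsum_of_injective hT fun ω => if c' = F ω then p ω else 0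

lemma mutualInfo_map {Ω Ω' α β : Type} (p : PMF Ω) (e : Ω → Ω') (A : Ω' → α) (B : Ω' → β) :
    mutualInfo (p.map e) A B = mutualInfo p (A ∘ e) (B ∘ e) := by
  simp only [mutualInfo, PMF.map_comp]
  rfl

variable {n m s : ℕ} (ε₁ ε₂ : unitInterval)

lemma sampleLaw_apply (d : Strings m × Bool) (x a : Fin n → Bool)
    (o : Option (Labeling n m s × Bool)) (b : Fin n → Bool) (M : Seed m s) :
    sampleLaw ε₁ ε₂ n m s (d, x, a, o, b, M) =
      (Fintype.card (Strings m × Bool) : ℝ≥0∞)⁻¹ * ((2⁻¹) ^ n * ((∏ i, coin ε₁ (a i)) *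
        (selection m s a o * ((∏ i, coin ε₂ (b i)) * (Fintype.card (Seed m s) : ℝ≥0∞)⁻¹)))) := by
  simp [sampleLaw, dprod_apply, iidSeq_apply]

lemma validLabeling_of_sampleLaw_ne_zero {d : Strings m × Bool} {x a : Fin n → Bool}
    {q : Labeling n m s × Bool} {b : Fin n → Bool} {M : Seed m s}
    (h : sampleLaw ε₁ ε₂ n m s (d, x, a, some q, b, M) ≠ 0) : ValidLabeling a q := by
  by_contra hq
  rw [sampleLaw_apply, selection_some, if_neg hq] at h
  simp at h

lemma secretKey_congr (M : Seed m s) (τ : Labeling n m s) {x x' : Fin n → Bool}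
    (h : ∀ j, x (τ (.inr j)) = x' (τ (.inr j))) : secretKey M τ x = secretKey M τ x' := by
  simp only [secretKey, h]

lemma maskedBits_of_not_erased (x : Fin n → Bool) {a : Fin n → Bool} {i : Fin n}
    (h : a i = false) : maskedBits x a i = x i := by
  simp [maskedBits, bobOutput, h]

/-- Bob received the whole key block, so his key equals Alice's and she decrypts the order `u ^^
q.2` correctly. -/
lemma transcriptOf_valid (k : Strings m) (u : Bool) (x : Fin n → Bool) {a : Fin n → Bool}
    (M : Seed m s) {q : Labeling n m s × Bool} (hq : ValidLabeling a q) :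
    transcriptOf k u x (maskedBits x a) M (some q) =
      [.inr (ciphertext k M q.1 x (u ^^ q.2)),
        .inl (M, some (q.1, orderBit M q.1 x (u ^^ q.2)))] := by
  have h1 : secretKey M q.1 (maskedBits x a) = secretKey M q.1 x :=
    secretKey_congr M q.1 fun j => maskedBits_of_not_erased x (hq.2.2 j)
  simp [transcriptOf, bobAnswer, aliceAnswer, orderBit, h1]

/-- Flips the bits in the positions given by `σ`. -/
def shiftBits (τ : Labeling n m s) (σ : Slot m s → Bool) (x : Fin n → Bool) : Fin n → Bool :=
  fun i => x i ^^ Function.extend τ σ (fun _ => false) i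

lemma shiftBits_apply (τ : Labeling n m s) (σ : Slot m s → Bool) (x : Fin n → Bool)
    (q : Slot m s) : shiftBits τ σ x (τ q) = (x (τ q) ^^ σ q) := by
  rw [shiftBits, τ.injective.extend_apply]

lemma shiftBits_shiftBits (τ : Labeling n m s) (σ : Slot m s → Bool) (x : Fin n → Bool) :
    shiftBits τ σ (shiftBits τ σ x) = x := by
  funext i
  simp [shiftBits]

/-- Flips confined to erased positions leave the visible bits alone; used for Bob's erasures and for
Eve's. -/
lemma shiftBits_eq_of_not {τ : Labeling n m s} {σ : Slot m s → Bool} {e : Fin n → Bool}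
    (h : ∀ q, σ q = true → e (τ q) = true) (x : Fin n → Bool) {i : Fin n} (hi : e i = false) :
    shiftBits τ σ x i = x i := by
  rw [shiftBits]
  by_cases hr : ∃ q, τ q = i
  · obtain ⟨q, rfl⟩ := hr
    rw [τ.injective.extend_apply]
    cases hσ : σ q
    · simp
    · rw [h q hσ] at hi; exact absurd hi (by simp)
  · rw [Function.extend_apply' _ _ _ hr]; simp

lemma bobOutput_shiftBits {τ : Labeling n m s} {σ : Slot m s → Bool} {a : Fin n → Bool}
    (h : ∀ q, σ q = true → a (τ q) = true) (x : Fin n → Bool) (i : Fin n) :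
    bobOutput (shiftBits τ σ x i) (a i) = bobOutput (x i) (a i) := by
  cases hi : a i
  · rw [shiftBits_eq_of_not h x hi]
  · rfl

lemma eveOutput_shiftBits {τ : Labeling n m s} {σ : Slot m s → Bool} {a b : Fin n → Bool}
    (h : ∀ q, σ q = true → (a (τ q) || b (τ q)) = true) (x : Fin n → Bool) (i : Fin n) :
    eveOutput (shiftBits τ σ x i) (a i) (b i) = eveOutput (x i) (a i) (b i) := by
  cases hi : (a i || b i)
  · rw [shiftBits_eq_of_not (e := fun i => a i || b i) h x hi]
  · simp only [eveOutput, hi, if_true]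

lemma toZMod_add_self (b : Bool) : toZMod b + toZMod b = 0 := by
  cases b <;> decide

lemma mutualInfo_law_otProtocol {α β : Type}
    (A : Execution (OTMsg n m s) (Option Bool) (Option Bool) m → α)
    (B : Execution (OTMsg n m s) (Option Bool) (Option Bool) m → β) :
    mutualInfo ((otProtocol n m s).law (degradedBEC ε₁ ε₂)) A B =
      mutualInfo (sampleLaw ε₁ ε₂ n m s) (A ∘ executionOf) (B ∘ executionOf) := by
  have h := congrArg (fun p : PMF (Execution (OTMsg n m s) (Option Bool) (Option Bool) m) =>
    mutualInfo p A B) (law_otProtocol ε₁ ε₂ n m s)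
  exact h.trans (mutualInfo_map _ _ _ _)

/-! #### Bob -/

/-- Changes the string that Bob has not chosen, and the erased bits that hide it. -/
def shiftUnchosen (δ : Fin m → Bool) : Sample n m s → Sample n m s
  | ((k, u), x, a, o, b, M) =>
    ((fun i => if i = u then k i else fun j => k i j ^^ δ j, u),
      (match o with
        | none => x
        | some (τ, θ) =>
          shiftBits τ (Sum.elim (fun p => if p.1 = θ then false else δ p.2) fun _ => false) x),
      a, o, b, M)

lemma shiftUnchosen_involutive (δ : Fin m → Bool) :
    Function.Involutive (shiftUnchosen δ : Sample n m s → Sample n m s) := by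
  rintro ⟨⟨k, u⟩, x, a, o, b, M⟩
  have hk : (fun i => if i = u then (if i = u then k i else fun j => k i j ^^ δ j)
      else fun j => (if i = u then k i else fun j => k i j ^^ δ j) j ^^ δ j) = k := by
    funext i j
    by_cases h : i = u <;> simp [h]
  rcases o with _ | ⟨τ, θ⟩
  · exact congrArg (fun k' => (((k', u), x, a, none, b, M) : Sample n m s)) hk
  · simp only [shiftUnchosen, shiftBits_shiftBits]
    exact congrArg (fun k' => (((k', u), x, a, some (τ, θ), b, M) : Sample n m s)) hk

/-- The unchosen string is masked by the block that Bob did not receive. Flipping the string and the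
mask together leaves the ciphertext, the key and Bob's outputs unchanged. -/
lemma viewB_shiftUnchosen (δ : Fin m → Bool) {ω : Sample n m s}
    (hω : sampleLaw ε₁ ε₂ n m s ω ≠ 0) :
    (executionOf (shiftUnchosen δ ω)).viewB = (executionOf ω).viewB := by
  obtain ⟨⟨k, u⟩, x, a, o, b, M⟩ := ω
  rcases o with _ | ⟨τ, θ⟩
  · rfl
  have hq := validLabeling_of_sampleLaw_ne_zero ε₁ ε₂ hω
  set σ : Slot m s → Bool := Sum.elim (fun p => if p.1 = θ then false else δ p.2) fun _ => false
    with hσdef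
  have hσ : ∀ q, σ q = true → a (τ q) = true := by
    rintro (⟨i, j⟩ | j) h
    · by_cases hi : i = θ
      · simp [σ, hi] at h
      · rw [Bool.eq_not_of_ne hi]
        exact hq.2.1 j
    · simp [σ] at h
  have hkey : secretKey M τ (shiftBits τ σ x) = secretKey M τ x :=
    secretKey_congr M τ fun j => by rw [shiftBits_apply]; simp [σ]
  simp only [shiftUnchosen, executionOf, Execution.viewB, ← hσdef]
  rw [transcriptOf_valid _ _ _ _ hq, transcriptOf_valid _ _ _ _ hq]
  simp only [bobOutput_shiftBits hσ, orderBit, hkey]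
  have hC : ciphertext (fun i => if i = u then k i else fun j => k i j ^^ δ j) M τ
      (shiftBits τ σ x) (u ^^ θ) = ciphertext k M τ x (u ^^ θ) := by
    funext i j
    simp only [ciphertext, hkey, shiftBits_apply]
    by_cases hi : i = u
    · simp [hi, σ]
    -- String `i` is masked by block `i ^^ u ^^ θ`, which is the received block `θ` exactly when `i
    -- = u`.
    · have h1 : (i ^^ (u ^^ θ)) ≠ θ := by
        revert hi; cases i <;> cases u <;> cases θ <;> decide
      simp only [hi, if_false, σ, Sum.elim_inl, h1, toZMod_xor]
      linear_combination toZMod_add_self (δ j)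
  rw [hC]

lemma leakToBob_otProtocol : (otProtocol n m s).leakToBob (degradedBEC ε₁ ε₂) = 0 := by
  have hu : ((sampleLaw ε₁ ε₂ n m s).map executionOf).map Execution.unchosen =
      PMF.uniformOfFintype (Fin m → Bool) := by
    have h := (otProtocol n m s).map_unchosen_law (degradedBEC ε₁ ε₂)
    rw [law_otProtocol] at h
    exact h
  have hI : (otProtocol n m s).leakToBob (degradedBEC ε₁ ε₂) = _ :=
    mutualInfo_law_otProtocol ε₁ ε₂ Execution.unchosen Execution.viewB
  rw [hI, ← nonpos_iff_eq_zero]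
  refine (mutualInfo_le_of_uniform _ _ _ Set.univ (fun v => ?_) (fun v _ c c' => ?_)).trans (by simp)
  · rw [← PMF.map_comp, hu, PMF.uniformOfFintype_apply]
  · refine map_apply_le_of_injective _ _ (shiftUnchosen fun j => c j ^^ c' j)
      (shiftUnchosen_involutive _).injective _ _ fun ω hω hF => ⟨?_, ?_⟩
    · obtain ⟨⟨k, u⟩, x, a, o, b, M⟩ := ω
      simp only [shiftUnchosen, sampleLaw_apply]
      exact le_rfl
    · rw [Prod.mk.injEq] at hF ⊢
      refine ⟨?_, (viewB_shiftUnchosen ε₁ ε₂ _ hω).trans hF.2⟩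
      obtain ⟨⟨k, u⟩, x, a, o, b, M⟩ := ω
      have h1 : k (!u) = c := hF.1
      funext j
      simp [Function.comp_apply, shiftUnchosen, executionOf, Execution.unchosen, h1]

/-! #### Alice -/

/-- The permutation of the channel uses that swaps the two blocks. -/
def swapBlocks (τ : Labeling n m s) : Equiv.Perm (Fin n) :=
  Equiv.Perm.viaEmbedding
    (Equiv.sumCongr (Equiv.prodCongr Equiv.boolNot (Equiv.refl (Fin m))) (Equiv.refl (Fin s))) τ

lemma swapBlocks_inl (τ : Labeling n m s) (i : Bool) (j : Fin m) :
    swapBlocks τ (τ (.inl (i, j))) = τ (.inl (!i, j)) := by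
  rw [swapBlocks, Equiv.Perm.viaEmbedding_apply]; rfl

lemma swapBlocks_inr (τ : Labeling n m s) (j : Fin s) :
    swapBlocks τ (τ (.inr j)) = τ (.inr j) := by
  rw [swapBlocks, Equiv.Perm.viaEmbedding_apply]; rfl

lemma swapBlocks_involutive (τ : Labeling n m s) : Function.Involutive (swapBlocks τ) := by
  intro i
  by_cases h : ∃ q, τ q = i
  · obtain ⟨⟨b, j⟩ | j, rfl⟩ := h
    · rw [swapBlocks_inl, swapBlocks_inl, Bool.not_not]
    · rw [swapBlocks_inr, swapBlocks_inr]
  · have : swapBlocks τ i = i := Equiv.Perm.viaEmbedding_apply_of_notMem _ _ _ h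
    rw [this, this]

lemma validLabeling_swapBlocks {a : Fin n → Bool} {τ : Labeling n m s} {θ : Bool}
    (h : ValidLabeling a (τ, θ)) : ValidLabeling (a ∘ swapBlocks τ) (τ, !θ) := by
  refine ⟨fun j => ?_, fun j => ?_, fun j => ?_⟩
  · simpa [swapBlocks_inl] using h.1 j
  · simpa [swapBlocks_inl] using h.2.1 j
  · simpa [swapBlocks_inr] using h.2.2 j

/-- Permuting the channel uses carries valid labelings to valid labelings bijectively, so Bob's
uniform choice has the same weight before and after a swap of blocks. -/
lemma card_validLabelings_comp (a : Fin n → Bool) (ρ : Equiv.Perm (Fin n)) :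
    (validLabelings m s (a ∘ ρ)).card = (validLabelings m s a).card := by
  classical
  refine Finset.card_equiv ((Equiv.embeddingCongr (Equiv.refl _) ρ).prodCongr (Equiv.refl _)) ?_
  rintro ⟨τ, θ⟩
  simp only [validLabelings, Finset.mem_filter, Finset.mem_univ, true_and]
  rfl

/-- Exchanges the two blocks and flips Bob's choice. -/
def flipChoice : Sample n m s → Sample n m s
  | ((k, u), x, a, none, b, M) => ((k, !u), x, a, none, b, M)
  | ((k, u), x, a, some (τ, θ), b, M) => ((k, !u), x, a ∘ swapBlocks τ, some (τ, !θ), b, M)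

lemma flipChoice_involutive :
    Function.Involutive (flipChoice : Sample n m s → Sample n m s) := by
  rintro ⟨⟨k, u⟩, x, a, _ | ⟨τ, θ⟩, b, M⟩
  · simp [flipChoice]
  · have : (a ∘ swapBlocks τ) ∘ swapBlocks τ = a := by
      funext i; simp [swapBlocks_involutive τ i]
    simp only [flipChoice, this, Bool.not_not]

lemma sampleLaw_le_flipChoice {ω : Sample n m s} (hω : sampleLaw ε₁ ε₂ n m s ω ≠ 0) :
    sampleLaw ε₁ ε₂ n m s ω ≤ sampleLaw ε₁ ε₂ n m s (flipChoice ω) := by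
  obtain ⟨⟨k, u⟩, x, a, _ | ⟨τ, θ⟩, b, M⟩ := ω
  · simp only [flipChoice, sampleLaw_apply]
    exact le_rfl
  · have hq := validLabeling_of_sampleLaw_ne_zero ε₁ ε₂ hω
    simp only [flipChoice, sampleLaw_apply, selection_some, if_pos hq,
      if_pos (validLabeling_swapBlocks hq), card_validLabelings_comp, Function.comp_apply]
    rw [Equiv.prod_comp (swapBlocks τ) fun i => coin ε₁ (a i)]

/-- Alice learns the labeling and only the sum `u ^^ θ`; flipping both bits and exchanging the
erasure patterns of the blocks is invisible to her. -/
lemma viewA_flipChoice {ω : Sample n m s} (hω : sampleLaw ε₁ ε₂ n m s ω ≠ 0) :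
    (executionOf (flipChoice ω)).viewA = (executionOf ω).viewA := by
  obtain ⟨⟨k, u⟩, x, a, _ | ⟨τ, θ⟩, b, M⟩ := ω
  · rfl
  · have hq := validLabeling_of_sampleLaw_ne_zero ε₁ ε₂ hω
    simp only [flipChoice, executionOf, Execution.viewA]
    rw [transcriptOf_valid _ _ _ _ hq, transcriptOf_valid _ _ _ _ (validLabeling_swapBlocks hq)]
    simp

lemma leakToAlice_otProtocol : (otProtocol n m s).leakToAlice (degradedBEC ε₁ ε₂) = 0 := by
  have hu : ((sampleLaw ε₁ ε₂ n m s).map executionOf).map Execution.choice =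
      PMF.uniformOfFintype (Bool) := by
    have h := (otProtocol n m s).map_choice_law (degradedBEC ε₁ ε₂)
    rw [law_otProtocol] at h
    exact h
  have hI : (otProtocol n m s).leakToAlice (degradedBEC ε₁ ε₂) = _ :=
    mutualInfo_law_otProtocol ε₁ ε₂ Execution.choice Execution.viewA
  rw [hI, ← nonpos_iff_eq_zero]
  refine (mutualInfo_le_of_uniform _ _ _ Set.univ (fun v => ?_) (fun v _ c c' => ?_)).trans (by simp)
  · rw [← PMF.map_comp, hu, PMF.uniformOfFintype_apply]
  · by_cases hc : c = c'
    · rw [hc]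
    refine map_apply_le_of_injective _ _ flipChoice flipChoice_involutive.injective _ _
      fun ω hω hF => ⟨sampleLaw_le_flipChoice ε₁ ε₂ hω, ?_⟩
    rw [Prod.mk.injEq] at hF ⊢
    refine ⟨?_, (viewA_flipChoice ε₁ ε₂ hω).trans hF.2⟩
    obtain ⟨⟨k, u⟩, x, a, _ | ⟨τ, θ⟩, b, M⟩ := ω
    · have h1 : u = c := hF.1
      rw [h1.symm] at hc
      exact (Bool.eq_not_of_ne (Ne.symm hc)).symm
    · have h1 : u = c := hF.1
      rw [h1.symm] at hc
      exact (Bool.eq_not_of_ne (Ne.symm hc)).symm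

/-! #### Eve -/

/-- The seed `M` maps the vectors with support in `E` onto all possible keys. -/
def CoversKeys (M : Seed m s) (E : Set (Fin s)) : Prop :=
  ∀ t, ∃ v : Fin s → ZMod 2, (∀ j, j ∉ E → v j = 0) ∧ M.mulVec v = t

open Classical in
/-- A vector with support in `E` that `M` maps to `t`, if possible. -/
def keyPreimage (M : Seed m s) (E : Set (Fin s)) (t : Option (Bool × Fin m) → ZMod 2) :
    Fin s → ZMod 2 :=
  if h : CoversKeys M E then (h t).choose else 0

/-- The change of the key that compensates a change `δ` of the strings and `η` of the order of the
blocks. -/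
def keyShift (δ : Strings m) (η c : Bool) (τ : Labeling n m s) (x : Fin n → Bool) :
    Option (Bool × Fin m) → ZMod 2
  | none => toZMod η
  | some (i, j) => toZMod (δ i j) + (toZMod (x (τ (.inl (i ^^ c, j)))) +
      toZMod (x (τ (.inl (i ^^ (c ^^ η), j)))))

/-- Changes the secrets of Alice and Bob, and the key bits erased for Eve. -/
def shiftSecrets (δ : Strings m) (η : Bool) : Sample n m s → Sample n m s
  | ((k, u), x, a, none, b, M) => ((fun i j => k i j ^^ δ i j, u ^^ η), x, a, none, b, M)
  | ((k, u), x, a, some (τ, θ), b, M) =>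
    ((fun i j => k i j ^^ δ i j, u ^^ η),
      shiftBits τ (Sum.elim (fun _ => false) fun j =>
        ofZMod (keyPreimage M {j | b (τ (.inr j)) = true} (keyShift δ η (u ^^ θ) τ x) j)) x,
      a, some (τ, θ), b, M)

lemma keyShift_shiftBits (δ : Strings m) (η c : Bool) (τ : Labeling n m s) (x : Fin n → Bool)
    (v : Fin s → Bool) :
    keyShift δ η c τ (shiftBits τ (Sum.elim (fun _ => false) v) x) = keyShift δ η c τ x := by
  funext r
  rcases r with _ | ⟨i, j⟩
  · rfl
  · simp [keyShift, shiftBits_apply]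

/-- The old and the new order of the blocks enter symmetrically. With `keyShift_shiftBits`, this
lets the second application of `shiftSecrets` recompute the same flips, which makes it an
involution. -/
lemma keyShift_xor (δ : Strings m) (η c : Bool) (τ : Labeling n m s) (x : Fin n → Bool) :
    keyShift δ η (c ^^ η) τ x = keyShift δ η c τ x := by
  funext r
  rcases r with _ | ⟨i, j⟩
  · rfl
  · simp [keyShift, add_comm]

lemma shiftSecrets_involutive (δ : Strings m) (η : Bool) :
    Function.Involutive (shiftSecrets δ η : Sample n m s → Sample n m s) := by
  rintro ⟨⟨k, u⟩, x, a, _ | ⟨τ, θ⟩, b, M⟩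
  · simp [shiftSecrets]
  · have h : ((u ^^ η) ^^ θ) = ((u ^^ θ) ^^ η) := by
      cases u <;> cases η <;> cases θ <;> rfl
    simp only [shiftSecrets, h, keyShift_xor, keyShift_shiftBits, shiftBits_shiftBits]
    simp

lemma secretKey_shiftBits (M : Seed m s) (τ : Labeling n m s) (x : Fin n → Bool)
    (v : Fin s → ZMod 2) :
    secretKey M τ (shiftBits τ (Sum.elim (fun _ => false) fun j => ofZMod (v j)) x) =
      secretKey M τ x + M.mulVec v := by
  rw [secretKey, secretKey, ← Matrix.mulVec_add]
  congr 1
  funext j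
  simp [shiftBits_apply, toZMod_xor]

/-- A key shift can absorb any change of the strings and of the block order in the ciphertexts. If
the seed is onto from the key positions erased for Eve, that shift is achieved by flipping only bits
she does not see. -/
lemma viewE_shiftSecrets (δ : Strings m) (η : Bool) {d : Strings m × Bool} {x a : Fin n → Bool}
    {o : Option (Labeling n m s × Bool)} {b : Fin n → Bool} {M : Seed m s}
    (hω : sampleLaw ε₁ ε₂ n m s (d, x, a, o, b, M) ≠ 0)
    (hM : ∀ q, o = some q → CoversKeys M {j | b (q.1 (.inr j)) = true}) :
    (executionOf (shiftSecrets δ η (d, x, a, o, b, M))).viewE =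
      (executionOf (d, x, a, o, b, M)).viewE := by
  obtain ⟨k, u⟩ := d
  rcases o with _ | ⟨τ, θ⟩
  · rfl
  have hq := validLabeling_of_sampleLaw_ne_zero ε₁ ε₂ hω
  have hM' := hM _ rfl
  set t := keyShift δ η (u ^^ θ) τ x with ht
  set v := keyPreimage M {j | b (τ (.inr j)) = true} t with hv
  have hv1 : ∀ j, b (τ (.inr j)) ≠ true → v j = 0 := by
    intro j hj
    rw [hv, keyPreimage, dif_pos hM']
    exact (hM' t).choose_spec.1 j hj
  have hv2 : M.mulVec v = t := by
    rw [hv, keyPreimage, dif_pos hM']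
    exact (hM' t).choose_spec.2
  set σ : Slot m s → Bool := Sum.elim (fun _ => false) fun j => ofZMod (v j) with hσdef
  have hσ : ∀ q, σ q = true → (a (τ q) || b (τ q)) = true := by
    rintro (p | j) h
    · simp [σ] at h
    · by_cases hj : b (τ (.inr j)) = true
      · simp [hj]
      · simp [σ, hv1 j hj, ofZMod] at h
  have hkey : secretKey M τ (shiftBits τ σ x) = secretKey M τ x + t := by
    rw [hσdef, secretKey_shiftBits, hv2]
  simp only [shiftSecrets, executionOf, Execution.viewE]
  rw [← ht, ← hv, ← hσdef, transcriptOf_valid _ _ _ _ hq, transcriptOf_valid _ _ _ _ hq]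
  simp only [eveOutput_shiftBits hσ]
  have h : ((u ^^ η) ^^ θ) = ((u ^^ θ) ^^ η) := by
    cases u <;> cases η <;> cases θ <;> rfl
  have hd : orderBit M τ (shiftBits τ σ x) ((u ^^ η) ^^ θ) = orderBit M τ x (u ^^ θ) := by
    have ht0 : t none = toZMod η := rfl
    rw [orderBit, orderBit, hkey, Pi.add_apply, ofZMod_add, ht0, ofZMod_toZMod, h]
    cases u <;> cases η <;> cases θ <;> simp
  have hC : ciphertext (fun i j => k i j ^^ δ i j) M τ (shiftBits τ σ x) ((u ^^ η) ^^ θ) =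
      ciphertext k M τ x (u ^^ θ) := by
    funext i j
    have ht1 : t (some (i, j)) = toZMod (δ i j) + (toZMod (x (τ (.inl (i ^^ (u ^^ θ), j)))) +
      toZMod (x (τ (.inl (i ^^ ((u ^^ θ) ^^ η), j))))) := rfl
    simp only [ciphertext, hkey, shiftBits_apply, h, Pi.add_apply, ht1]
    simp only [σ, Sum.elim_inl, Bool.xor_false, toZMod_xor]
    linear_combination toZMod_add_self (δ i j) +
      toZMod_add_self (x (τ (.inl (i ^^ ((u ^^ θ) ^^ η), j))))
  rw [hd, hC]

/-- The views of Eve for which the secret key is perfectly hidden from her. -/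
def securedViews (n m s : ℕ) : Set (List (Option Bool) × List (OTMsg n m s)) :=
  {v | ∀ C M τ d, v.2 = [.inr C, .inl (M, some (τ, d))] →
    CoversKeys M {j | erasures n v.1 (τ (.inr j)) = true}}

lemma erasures_eve (x a b : Fin n → Bool) :
    erasures n (List.ofFn fun i => eveOutput (x i) (a i) (b i)) = fun i => a i || b i := by
  funext i
  rw [erasures, getD_ofFn, eveOutput]
  cases (a i || b i) <;> rfl

/-- Bob has no erasures in the key block, so there Eve's erasure pattern is exactly `b`; this makes
the condition a function of her view. Aborted runs satisfy it vacuously. -/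
lemma viewE_mem_securedViews_iff {d : Strings m × Bool} {x a : Fin n → Bool}
    {o : Option (Labeling n m s × Bool)} {b : Fin n → Bool} {M : Seed m s}
    (hω : sampleLaw ε₁ ε₂ n m s (d, x, a, o, b, M) ≠ 0) :
    (executionOf (d, x, a, o, b, M)).viewE ∈ securedViews n m s ↔
      ∀ q, o = some q → CoversKeys M {j | b (q.1 (.inr j)) = true} := by
  obtain ⟨k, u⟩ := d
  rcases o with _ | q
  · simp [securedViews, executionOf, Execution.viewE, transcriptOf, bobAnswer]
  have hq := validLabeling_of_sampleLaw_ne_zero ε₁ ε₂ hω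
  have hE : {j | erasures n (executionOf ((k, u), x, a, some q, b, M)).viewE.1 (q.1 (.inr j)) = true}
      = {j | b (q.1 (.inr j)) = true} := by
    ext j
    simp only [executionOf, Execution.viewE, erasures_eve, Set.mem_ofPred_eq, hq.2.2 j,
      Bool.false_or]
  have ht : (executionOf ((k, u), x, a, some q, b, M)).viewE.2 = _ := transcriptOf_valid k u x M hq
  constructor
  · rintro h q' hq'
    obtain rfl : q = q' := Option.some.inj hq'
    have := h _ _ _ _ ht
    rwa [hE] at this
  · intro h C M' τ d hv
    rw [ht] at hv
    simp only [List.cons.injEq, Sum.inr.injEq, Sum.inl.injEq, Prod.mk.injEq, Option.some.injEq] at hv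
    obtain ⟨-, ⟨rfl, rfl, -⟩, -⟩ := hv
    rw [hE]
    exact h q rfl

lemma leakToEve_otProtocol_le :
    (otProtocol n m s).leakToEve (degradedBEC ε₁ ε₂) ≤ (sampleLaw ε₁ ε₂ n m s).toOuterMeasure
      {ω | ∃ q, ω.2.2.2.1 = some q ∧
        ¬ CoversKeys ω.2.2.2.2.2 {j | ω.2.2.2.2.1 (q.1 (.inr j)) = true}} *
      ENNReal.ofReal (Real.log (Fintype.card (Strings m × Bool)) + 1) := by
  have hu : ((sampleLaw ε₁ ε₂ n m s).map executionOf).map Execution.secrets =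
      PMF.uniformOfFintype (Strings m × Bool) := by
    have h := (otProtocol n m s).map_secrets_law (degradedBEC ε₁ ε₂)
    rw [law_otProtocol] at h
    exact h
  have hI : (otProtocol n m s).leakToEve (degradedBEC ε₁ ε₂) = _ :=
    mutualInfo_law_otProtocol ε₁ ε₂ Execution.secrets Execution.viewE
  rw [hI]
  refine (mutualInfo_le_of_uniform _ _ _ (securedViews n m s) (fun v => ?_)
    (fun v hv c c' => ?_)).trans ?_
  · rw [← PMF.map_comp, hu, PMF.uniformOfFintype_apply]
  · refine map_apply_le_of_injective _ _
      (shiftSecrets (fun i j => c.1 i j ^^ c'.1 i j) (c.2 ^^ c'.2))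
      (shiftSecrets_involutive _ _).injective _ _ fun ω hω hF => ⟨?_, ?_⟩
    · obtain ⟨⟨k, u⟩, x, a, _ | ⟨τ, θ⟩, b, M⟩ := ω
      · simp only [shiftSecrets, sampleLaw_apply]
        exact le_rfl
      · simp only [shiftSecrets, sampleLaw_apply]
        exact le_rfl
    · rw [Prod.mk.injEq] at hF ⊢
      obtain ⟨⟨k, u⟩, x, a, o, b, M⟩ := ω
      refine ⟨?_, (viewE_shiftSecrets ε₁ ε₂ _ _ hω ?_).trans hF.2⟩
      · obtain ⟨rfl, -⟩ := hF
        refine Prod.ext ?_ ?_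
        · rcases o with _ | ⟨τ, θ⟩ <;> funext i j <;>
            simp [Function.comp_apply, shiftSecrets, executionOf, Execution.secrets]
        · rcases o with _ | ⟨τ, θ⟩ <;>
            simp [Function.comp_apply, shiftSecrets, executionOf, Execution.secrets]
      · rw [← viewE_mem_securedViews_iff ε₁ ε₂ hω]
        have h2 := hF.2
        rw [Function.comp_apply] at h2
        rw [h2]
        exact hv
  · gcongr ?_ * _
    refine PMF.toOuterMeasure_mono _ ?_
    rintro ⟨d, x, a, o, b, M⟩ ⟨h, hω⟩
    have h' : (executionOf (d, x, a, o, b, M)).viewE ∉ securedViews n m s := h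
    rw [viewE_mem_securedViews_iff ε₁ ε₂ hω] at h'
    push Not at h'
    exact h'

/-! #### Correctness -/

/-- With a valid labeling Bob knows the key and the block `u ^^ (u ^^ θ) = θ` that masks `K_U`, so
decryption is exact and only an abort can cause an error. -/
lemma errorProb_otProtocol_le :
    (otProtocol n m s).errorProb (degradedBEC ε₁ ε₂) ≤
      (sampleLaw ε₁ ε₂ n m s).toOuterMeasure {ω | ω.2.2.2.1 = none} := by
  rw [Protocol.errorProb, law_otProtocol]
  refine (PMF.toOuterMeasure_map_apply _ _ _).trans_le (PMF.toOuterMeasure_mono _ ?_)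
  rintro ⟨⟨k, u⟩, x, a, o, b, M⟩ ⟨h, hω⟩
  rcases o with _ | ⟨τ, θ⟩
  · rfl
  exfalso
  refine h ?_
  have hq := validLabeling_of_sampleLaw_ne_zero ε₁ ε₂ hω
  have hkey : secretKey M τ (maskedBits x a) = secretKey M τ x :=
    secretKey_congr M τ fun j => maskedBits_of_not_erased x (hq.2.2 j)
  change bobEstimate u (received n (List.ofFn fun i => bobOutput (x i) (a i)))
    (transcriptOf k u x (maskedBits x a) M (some (τ, θ))) = k u
  rw [received_ofFn, transcriptOf_valid _ _ _ _ hq]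
  funext j
  have hx : maskedBits x a (τ (.inl (θ, j))) = x (τ (.inl (θ, j))) :=
    maskedBits_of_not_erased x (hq.1 j)
  have hc : orderBit M τ (maskedBits x a) (orderBit M τ x (u ^^ θ)) = (u ^^ θ) := by
    simp [orderBit, hkey]
  simp only [bobEstimate, decrypt, hc, ciphertext, hkey]
  rw [show (u ^^ (u ^^ θ)) = θ by simp, hx,
    show toZMod (k u j) + toZMod (x (τ (.inl (θ, j)))) + secretKey M τ x (some (u, j)) +
      toZMod (x (τ (.inl (θ, j)))) + secretKey M τ x (some (u, j)) = toZMod (k u j) by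
      have h2 : secretKey M τ x (some (u, j)) + secretKey M τ x (some (u, j)) = 0 :=
        CharTwo.add_self_eq_zero _
      linear_combination toZMod_add_self (x (τ (.inl (θ, j)))) + h2]
  simp

end Privacy

/-! ### Probabilities of the failures of the protocol -/

section Failure

/-- Conditioning on the first component: `A` collects its bad values, and `c` bounds the conditional
probability for all others. -/
lemma dprod_toOuterMeasure_le {α β : Type} (p : PMF α) (q : α → PMF β) (S : Set (α × β))
    (A : Set α) (c : ℝ≥0∞) (h : ∀ a, a ∉ A → (q a).toOuterMeasure {b | (a, b) ∈ S} ≤ c) :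
    (dprod p q).toOuterMeasure S ≤ p.toOuterMeasure A + c := by
  rw [PMF.toOuterMeasure_apply, ENNReal.tsum_prod', PMF.toOuterMeasure_apply]
  calc _ ≤ ∑' a, (A.indicator p a + p a * c) := by
        refine ENNReal.tsum_le_tsum fun a => ?_
        have h1 : ∑' b, S.indicator (dprod p q) (a, b) =
            p a * (q a).toOuterMeasure {b | (a, b) ∈ S} := by
          rw [PMF.toOuterMeasure_apply, ← ENNReal.tsum_mul_left]
          refine tsum_congr fun b => ?_
          by_cases hb : (a, b) ∈ S
          · rw [Set.indicator_of_mem hb, Set.indicator_of_mem (s := {b | (a, b) ∈ S}) hb,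
              dprod_apply]
          · rw [Set.indicator_of_notMem hb, Set.indicator_of_notMem (s := {b | (a, b) ∈ S}) hb,
              mul_zero]
        rw [h1]
        by_cases ha : a ∈ A
        · rw [Set.indicator_of_mem ha]
          refine le_add_right (mul_le_of_le_one_right' ?_)
          rw [← (q a).tsum_coe, PMF.toOuterMeasure_apply]
          exact ENNReal.tsum_le_tsum fun b => Set.indicator_le_self _ _ _
        · exact le_add_left (mul_le_mul_right (h a ha) _)
    _ = _ := by rw [ENNReal.tsum_add, ENNReal.tsum_mul_right, PMF.tsum_coe, one_mul]

lemma dprod_toOuterMeasure_le' {α β : Type} (p : PMF α) (q : α → PMF β) (S : Set (α × β))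
    (c : ℝ≥0∞) (h : ∀ a, (q a).toOuterMeasure {b | (a, b) ∈ S} ≤ c) :
    (dprod p q).toOuterMeasure S ≤ c := by
  simpa using dprod_toOuterMeasure_le p q S ∅ c fun a _ => h a

lemma sum_coin_mul_ite (ε : unitInterval) (c : Bool) {w : ℝ} (hw : 0 ≤ w) :
    ∑ b, coin ε b * (if b = c then ENNReal.ofReal w else 1) =
      ENNReal.ofReal (1 - (if c then (ε : ℝ) else 1 - ε) + (if c then (ε : ℝ) else 1 - ε) * w) := by
  have h0 := ε.2.1
  have h1 : (0 : ℝ) ≤ 1 - ε := by linarith [ε.2.2]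
  cases c
  · simp only [Fintype.sum_bool, coin, PMF.ofFintype_apply]
    simp only [if_true, Bool.true_eq_false, if_false, Bool.false_eq_true, mul_one]
    rw [← ENNReal.ofReal_mul h1, ← ENNReal.ofReal_add h0 (by positivity)]
    congr 1; ring
  · simp only [Fintype.sum_bool, coin, PMF.ofFintype_apply]
    simp only [if_true, if_false, Bool.false_eq_true, mul_one]
    rw [← ENNReal.ofReal_mul h0, ← ENNReal.ofReal_add (by positivity) h1]
    congr 1; ring

/-- A large deviation bound for independent coins. -/
lemma exists_coin_tail (ε : unitInterval) (c : Bool) {ν : ℝ}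
    (hν : (if c then (ε : ℝ) else 1 - ε) < ν) :
    ∃ q : ℝ≥0∞, q < 1 ∧ ∀ (n l : ℕ) (ι : Fin l ↪ Fin n) (N : ℕ), ν * l ≤ N →
      (iidSeq (coin ε) n).toOuterMeasure
        {w | N ≤ (Finset.univ.filter fun j => w (ι j) = c).card} ≤ q ^ l := by
  classical
  have hp0 : (0 : ℝ) ≤ (if c then (ε : ℝ) else 1 - ε) := by
    split_ifs
    · exact ε.2.1
    · linarith [ε.2.2]
  have hp1 : (if c then (ε : ℝ) else 1 - ε) ≤ 1 := by
    split_ifs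
    · exact ε.2.2
    · linarith [ε.2.1]
  obtain ⟨t, ht, hlt⟩ := exists_exp_moment_lt hp0 hp1 hν
  have hsum := sum_coin_mul_ite ε c (Real.exp_pos t).le
  set p := (if c then (ε : ℝ) else 1 - ε)
  set M := 1 - p + p * Real.exp t with hM
  have hM0 : 0 < M := by
    have := Real.one_le_exp ht.le
    nlinarith
  refine ⟨ENNReal.ofReal (M * Real.exp (-(ν * t))), ?_, fun n l ι N hN => ?_⟩
  · rw [← ENNReal.ofReal_one, ENNReal.ofReal_lt_ofReal_iff one_pos, Real.exp_neg, ← div_eq_mul_inv,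
      div_lt_one (Real.exp_pos _)]
    exact hlt
  set E := ENNReal.ofReal (Real.exp t) with hE
  have hE1 : 1 ≤ E := by rw [hE, ENNReal.one_le_ofReal]; exact Real.one_le_exp ht.le
  have hEE : ENNReal.ofReal (Real.exp (-t)) * E = 1 := by
    rw [hE, ← ENNReal.ofReal_mul (Real.exp_pos _).le, ← Real.exp_add]; simp
  rw [PMF.toOuterMeasure_apply_fintype]
  -- Markov's inequality for the exponential weight carried by the positions in the range of `ι`;
  -- the sum then factorises over positions.
  calc _ ≤ ∑ w : Fin n → Bool, ENNReal.ofReal (Real.exp (-t)) ^ N *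
        ∏ i, (coin ε (w i) * if i ∈ Finset.univ.map ι then (if w i = c then E else 1) else 1) := by
        refine Finset.sum_le_sum fun w _ => ?_
        refine Set.indicator_apply_le' (fun hw => ?_) (fun _ => bot_le)
        rw [iidSeq_apply, Finset.prod_mul_distrib, Finset.prod_ite_mem, Finset.univ_inter,
          Finset.prod_map, Finset.prod_ite, Finset.prod_const_one, mul_one, Finset.prod_const]
        calc _ = ENNReal.ofReal (Real.exp (-t)) ^ N * ((∏ i, coin ε (w i)) * E ^ N) := by
              rw [mul_left_comm, ← mul_pow, hEE, one_pow, mul_one]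
          _ ≤ _ := by
              gcongr
              exact hw
    _ = ENNReal.ofReal (Real.exp (-t)) ^ N * ENNReal.ofReal M ^ l := by
        rw [← Finset.mul_sum]
        congr 1
        have h := Finset.prod_univ_sum (fun _ : Fin n => (Finset.univ : Finset Bool))
          (fun i b => coin ε b * if i ∈ Finset.univ.map ι then (if b = c then E else 1) else 1)
        rw [Fintype.piFinset_univ] at h
        rw [← h]
        have h2 : ∀ i, ∑ b, coin ε b * (if i ∈ Finset.univ.map ι then (if b = c then E else 1) else 1)
            = if i ∈ Finset.univ.map ι then ENNReal.ofReal M else 1 := by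
          intro i
          split_ifs
          · exact hsum
          · simp only [mul_one]
            rw [← tsum_fintype (L := .unconditional _), PMF.tsum_coe]
        simp only [h2]
        rw [Finset.prod_ite_mem, Finset.univ_inter, Finset.prod_const, Finset.card_map,
          Finset.card_univ, Fintype.card_fin]
    _ ≤ _ := by
        rw [← ENNReal.ofReal_pow hM0.le, ← ENNReal.ofReal_pow (Real.exp_pos _).le,
          ← ENNReal.ofReal_pow (by positivity), ← ENNReal.ofReal_mul (by positivity)]
        refine ENNReal.ofReal_le_ofReal ?_
        rw [mul_pow, mul_comm]
        gcongr
        rw [← Real.exp_nat_mul, ← Real.exp_nat_mul, Real.exp_le_exp]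
        nlinarith

/-! #### The seed -/

variable {n m s : ℕ}

/-- Duality: if the image of the vectors supported in `E` is a proper subspace, some nonzero
functional kills it, and its coordinates give `c`. -/
lemma exists_vecMul_eq_zero (M : Seed m s) (E : Set (Fin s)) (h : ¬ CoversKeys M E) :
    ∃ c : Option (Bool × Fin m) → ZMod 2, c ≠ 0 ∧ ∀ j ∈ E, Matrix.vecMul c M j = 0 := by
  classical
  set V : Submodule (ZMod 2) (Fin s → ZMod 2) :=
    { carrier := {v | ∀ j, j ∉ E → v j = 0}
      add_mem' := fun {v w} hv hw j hj => by simp [hv j hj, hw j hj]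
      zero_mem' := fun j _ => rfl
      smul_mem' := fun c v hv j hj => by simp [hv j hj] } with hV
  have hlt : V.map M.mulVecLin < ⊤ := by
    rw [lt_top_iff_ne_top]
    intro htop
    refine h fun t => ?_
    obtain ⟨v, hv, hvt⟩ := (htop ▸ Submodule.mem_top : t ∈ V.map M.mulVecLin)
    exact ⟨v, hv, hvt⟩
  obtain ⟨f, hf, hle⟩ := Submodule.exists_le_ker_of_lt_top _ hlt
  have hfd : ∀ t, f t = ∑ r, t r * f (Pi.single r 1) := by
    intro t
    conv_lhs => rw [pi_eq_sum_univ' t, map_sum]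
    refine Finset.sum_congr rfl fun r _ => ?_
    rw [map_smul, smul_eq_mul]
  refine ⟨fun r => f (Pi.single r 1), fun h0 => hf ?_, fun j hj => ?_⟩
  · refine LinearMap.ext fun t => ?_
    rw [hfd]
    exact Finset.sum_eq_zero fun r _ => by rw [congrFun h0 r]; simp
  · have hmem : M.mulVec (Pi.single j 1) ∈ V.map M.mulVecLin := by
      refine ⟨Pi.single j 1, fun i hi => ?_, rfl⟩
      rw [Pi.single_eq_of_ne]
      rintro rfl
      exact hi hj
    have h0 := LinearMap.mem_ker.1 (hle hmem)
    rw [hfd] at h0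
    rw [← h0]
    simp only [Matrix.vecMul, dotProduct, Matrix.mulVec_single_one, Matrix.col_apply]
    exact Finset.sum_congr rfl fun r _ => mul_comm _ _

open Classical in
-- Where `c` is nonzero, the entries of that row in the columns of `E` can be changed arbitrarily,
-- and `Matrix.vecMul c` reads the change back. So the `2 ^ E.card` translates of the solution set
-- are disjoint.
lemma card_vecMul_eq_zero_le (c : Option (Bool × Fin m) → ZMod 2) (hc : c ≠ 0)
    (E : Finset (Fin s)) :
    (Finset.univ.filter fun M : Seed m s => ∀ j ∈ E, Matrix.vecMul c M j = 0).card * 2 ^ E.card ≤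
      Fintype.card (Seed m s) := by
  obtain ⟨r₀, hr₀⟩ := Function.ne_iff.1 hc
  have hr₁ : c r₀ = 1 := by
    have : ∀ z : ZMod 2, z ≠ 0 → z = 1 := by decide
    exact this _ hr₀
  have hcard : Fintype.card ({M : Seed m s // ∀ j ∈ E, Matrix.vecMul c M j = 0} × (E → ZMod 2)) =
      (Finset.univ.filter fun M : Seed m s => ∀ j ∈ E, Matrix.vecMul c M j = 0).card
        * 2 ^ E.card := by
    rw [Fintype.card_prod, Fintype.card_subtype]
    simp [ZMod.card]
  rw [← hcard]
  refine Fintype.card_le_of_injective (fun p => p.1.1 + Matrix.of fun r j =>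
    if h : r = r₀ ∧ j ∈ E then p.2 ⟨j, h.2⟩ else 0) ?_
  have hval : ∀ (p : {M : Seed m s // ∀ j ∈ E, Matrix.vecMul c M j = 0} × (E → ZMod 2)) (j : E),
      Matrix.vecMul c (p.1.1 + Matrix.of fun r j => if h : r = r₀ ∧ j ∈ E then p.2 ⟨j, h.2⟩ else 0) j
        = p.2 j := by
    intro p j
    rw [Matrix.vecMul_add, Pi.add_apply, p.1.2 j j.2, zero_add]
    simp only [Matrix.vecMul, dotProduct, Matrix.of_apply]
    rw [Finset.sum_eq_single r₀]
    · simp [hr₁, j.2]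
    · intro r _ hr; simp [hr]
    · simp
  intro p p' hpp
  have h2 : p.2 = p'.2 := by
    funext j
    rw [← hval p j, ← hval p' j]
    exact congrArg (fun M : Seed m s => Matrix.vecMul c M j) hpp
  refine Prod.ext (Subtype.ext ?_) h2
  simp only [h2] at hpp
  exact add_right_cancel hpp

/-- A union bound over the `2 ^ (2 * m + 1)` possible functionals `c`; each vanishes on the columns
of `E` with probability at most `2⁻¹ ^ E.card`. -/
lemma toOuterMeasure_not_coversKeys_le (E : Finset (Fin s)) :
    (PMF.uniformOfFintype (Seed m s)).toOuterMeasure {M | ¬ CoversKeys M E} ≤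
      2 ^ (2 * m + 1) * 2⁻¹ ^ E.card := by
  classical
  have hcard : Fintype.card (Option (Bool × Fin m) → ZMod 2) = 2 ^ (2 * m + 1) := by
    simp [ZMod.card, mul_comm]
  calc _ ≤ (PMF.uniformOfFintype (Seed m s)).toOuterMeasure
        (⋃ c : {c : Option (Bool × Fin m) → ZMod 2 // c ≠ 0},
          {M | ∀ j ∈ E, Matrix.vecMul c.1 M j = 0}) := by
        refine MeasureTheory.measure_mono fun M hM => ?_
        obtain ⟨c, hc, h⟩ := exists_vecMul_eq_zero M E hM
        exact Set.mem_iUnion.2 ⟨⟨c, hc⟩, h⟩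
    _ ≤ ∑ c : {c : Option (Bool × Fin m) → ZMod 2 // c ≠ 0},
          (PMF.uniformOfFintype (Seed m s)).toOuterMeasure
            {M | ∀ j ∈ E, Matrix.vecMul c.1 M j = 0} := MeasureTheory.measure_iUnion_fintype_le _ _
    _ ≤ ∑ c : {c : Option (Bool × Fin m) → ZMod 2 // c ≠ 0}, 2⁻¹ ^ E.card := by
        refine Finset.sum_le_sum fun c _ => ?_
        have h1 := card_vecMul_eq_zero_le c.1 c.2 E
        rw [PMF.toOuterMeasure_uniformOfFintype_apply]
        refine ENNReal.div_le_of_le_mul ?_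
        rw [Fintype.card_subtype, ← ENNReal.inv_pow, mul_comm, ← div_eq_mul_inv,
          ENNReal.le_div_iff_mul_le (Or.inl (by simp)) (Or.inl (by simp))]
        exact_mod_cast h1
    _ ≤ _ := by
        rw [Finset.sum_const, nsmul_eq_mul]
        gcongr
        rw [Finset.card_univ]
        have := Fintype.card_subtype_le fun c : Option (Bool × Fin m) → ZMod 2 => c ≠ 0
        rw [hcard] at this
        exact_mod_cast this

/-! #### The labeling -/

lemma validLabelings_nonempty {a : Fin n → Bool}
    (h1 : m ≤ (Finset.univ.filter fun i => a i = true).card)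
    (h2 : m + s ≤ (Finset.univ.filter fun i => a i = false).card) :
    (validLabelings m s a).Nonempty := by
  classical
  rw [← Fintype.card_subtype] at h1 h2
  obtain ⟨e₁⟩ : Nonempty (Fin m ↪ {i // a i = true}) :=
    Function.Embedding.nonempty_of_card_le (by simpa using h1)
  obtain ⟨e₂⟩ : Nonempty (Fin m ⊕ Fin s ↪ {i // a i = false}) :=
    Function.Embedding.nonempty_of_card_le (by simpa using h2)
  have hdisj : ∀ x y, (e₁ x : Fin n) ≠ e₂ y := by
    intro x y h
    have := (e₁ x).2
    rw [h, (e₂ y).2] at this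
    exact absurd this (by simp)
  let f : Slot m s → Fin n := Sum.elim
    (fun p => if p.1 = true then (e₁ p.2 : Fin n) else e₂ (.inl p.2)) fun j => e₂ (.inr j)
  have hf : Function.Injective f := by
    rintro (⟨_ | _, j⟩ | j) (⟨_ | _, j'⟩ | j') h
    · have := e₂.injective (Subtype.ext (by simpa [f] using h)); simpa using this
    · exact absurd (by simpa [f] using h.symm) (hdisj j' (.inl j))
    · have := e₂.injective (Subtype.ext (by simpa [f] using h)); simp at this
    · exact absurd (by simpa [f] using h) (hdisj j (.inl j'))
    · have := e₁.injective (Subtype.ext (by simpa [f] using h)); simpa using this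
    · exact absurd (by simpa [f] using h) (hdisj j (.inr j'))
    · have := e₂.injective (Subtype.ext (by simpa [f] using h)); simp at this
    · exact absurd (by simpa [f] using h.symm) (hdisj j' (.inr j))
    · have := e₂.injective (Subtype.ext (by simpa [f] using h)); simpa using this
  refine ⟨(⟨f, hf⟩, false), ?_⟩
  simp only [validLabelings, Finset.mem_filter, Finset.mem_univ, true_and]
  refine ⟨fun j => ?_, fun j => ?_, fun j => ?_⟩
  · simpa [f] using (e₂ (.inl j)).2
  · simpa [f] using (e₁ j).2
  · simpa [f] using (e₂ (.inr j)).2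

lemma not_nonempty_validLabelings {a : Fin n → Bool} (h : ¬ (validLabelings m s a).Nonempty) :
    n + 1 - m ≤ (Finset.univ.filter fun i => a i = false).card ∨
      n + 1 - (m + s) ≤ (Finset.univ.filter fun i => a i = true).card := by
  have hsum : (Finset.univ.filter fun i => a i = true).card +
      (Finset.univ.filter fun i => a i = false).card = n := by
    have := Finset.card_filter_add_card_filter_not (s := (Finset.univ : Finset (Fin n)))
      (fun i => a i = true)
    simpa using this
  by_contra! hne
  exact h (validLabelings_nonempty (by omega) (by omega))

variable (ε₁ ε₂ : unitInterval)

lemma toOuterMeasure_aborted_le :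
    (sampleLaw ε₁ ε₂ n m s).toOuterMeasure {ω | ω.2.2.2.1 = none} ≤
      (iidSeq (coin ε₁) n).toOuterMeasure
          {a | n + 1 - m ≤ (Finset.univ.filter fun i => a i = false).card} +
        (iidSeq (coin ε₁) n).toOuterMeasure
          {a | n + 1 - (m + s) ≤ (Finset.univ.filter fun i => a i = true).card} := by
  refine dprod_toOuterMeasure_le' _ _ _ _ fun d => dprod_toOuterMeasure_le' _ _ _ _ fun x => ?_
  refine (dprod_toOuterMeasure_le _ _ _ {a | ¬ (validLabelings m s a).Nonempty} 0
    fun a ha => ?_).trans ?_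
  · have ha' : (validLabelings m s a).Nonempty := not_not.1 ha
    refine (dprod_toOuterMeasure_le _ _ _ {none} 0 fun o ho => ?_).trans (le_of_eq ?_)
    · have : {b : (Fin n → Bool) × Seed m s | (o, b) ∈ {b : Option (Labeling n m s × Bool) ×
          (Fin n → Bool) × Seed m s | (a, b) ∈ {b : (Fin n → Bool) × Option (Labeling n m s × Bool) ×
          (Fin n → Bool) × Seed m s | (x, b) ∈ {b : (Fin n → Bool) × (Fin n → Bool) ×
          Option (Labeling n m s × Bool) × (Fin n → Bool) × Seed m s |
            (d, b) ∈ {ω : Sample n m s | ω.2.2.2.1 = none}}}}} = ∅ :=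
        Set.eq_empty_of_forall_notMem fun b hb => ho hb
      rw [this, MeasureTheory.measure_empty]
    · rw [PMF.toOuterMeasure_apply_singleton, selection_none, if_pos ha', zero_add]
  · rw [add_zero]
    exact (MeasureTheory.measure_mono fun a ha => not_nonempty_validLabelings ha).trans
      (MeasureTheory.measure_union_le _ _)

/-- Either Eve sees at least `N` key bits, or at least `s + 1 - N` are erased for her and the random
seed rarely fails. The first bound is uniform in `ι` because the labeling is drawn before `b`. -/
lemma toOuterMeasure_insecure_le (N : ℕ) (c : ℝ≥0∞)
    (hc : ∀ ι : Fin s ↪ Fin n, (iidSeq (coin ε₂) n).toOuterMeasure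
      {b | N ≤ (Finset.univ.filter fun j => b (ι j) = false).card} ≤ c) :
    (sampleLaw ε₁ ε₂ n m s).toOuterMeasure {ω | ∃ q, ω.2.2.2.1 = some q ∧
        ¬ CoversKeys ω.2.2.2.2.2 {j | ω.2.2.2.2.1 (q.1 (.inr j)) = true}} ≤
      c + 2 ^ (2 * m + 1) * 2⁻¹ ^ (s + 1 - N) := by
  refine dprod_toOuterMeasure_le' _ _ _ _ fun d => dprod_toOuterMeasure_le' _ _ _ _ fun x =>
    dprod_toOuterMeasure_le' _ _ _ _ fun a => dprod_toOuterMeasure_le' _ _ _ _ fun o => ?_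
  rcases o with _ | q
  · refine (MeasureTheory.measure_mono (t := ∅) ?_).trans (by simp)
    rintro b ⟨q, hq, -⟩
    exact absurd hq (by simp)
  refine (dprod_toOuterMeasure_le _ _ _ {b | N ≤ (Finset.univ.filter
    fun j => b (q.1 (.inr j)) = false).card} (2 ^ (2 * m + 1) * 2⁻¹ ^ (s + 1 - N))
    fun b hb => ?_).trans ?_
  · have hsum := Finset.card_filter_add_card_filter_not (s := (Finset.univ : Finset (Fin s)))
      (fun j => b (q.1 (.inr j)) = true)
    simp only [Bool.not_eq_true, Finset.card_univ, Fintype.card_fin] at hsum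
    have hb' : ¬ N ≤ (Finset.univ.filter fun j => b (q.1 (.inr j)) = false).card := hb
    refine (MeasureTheory.measure_mono fun M hM => ?_).trans
      ((toOuterMeasure_not_coversKeys_le
        (Finset.univ.filter fun j => b (q.1 (.inr j)) = true)).trans ?_)
    · obtain ⟨q', hq', hM'⟩ := hM
      obtain rfl : q = q' := Option.some.inj hq'
      simpa using hM'
    · exact mul_le_mul_right (pow_le_pow_right_of_le_one' (by simp) (by omega)) _
  · gcongr
    exact hc (Function.Embedding.inr.trans q.1)

end Failure

/-! ### Achievability -/

section Achievability

/-- The linear factor bounds the logarithm of the number of secrets, by which the failure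
probability is multiplied in the leakage to Eve. -/
lemma tendsto_linear_mul_pow_floor {q : ℝ≥0∞} (hq : q < 1) {η : ℝ} (hη : 0 < η) :
    Tendsto (fun n : ℕ => q ^ ⌊η * n⌋₊ * (2 * n + 4)) atTop (𝓝 0) := by
  set r := q.toReal with hr
  have hr0 : 0 ≤ r := ENNReal.toReal_nonneg
  have hr1 : r < 1 := by
    have := (ENNReal.toReal_lt_toReal hq.ne_top ENNReal.one_ne_top).2 hq
    simpa using this
  have hfl : Tendsto (fun n : ℕ => ⌊η * (n : ℝ)⌋₊) atTop atTop :=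
    tendsto_nat_floor_atTop.comp (tendsto_natCast_atTop_atTop.const_mul_atTop hη)
  have hreal : Tendsto (fun k : ℕ => (2 / η) * (k * r ^ k) + (2 / η + 4) * r ^ k) atTop (𝓝 0) := by
    have h1 := (tendsto_self_mul_const_pow_of_lt_one hr0 hr1).const_mul (2 / η)
    have h2 := (tendsto_pow_atTop_nhds_zero_of_lt_one hr0 hr1).const_mul (2 / η + 4)
    simpa using h1.add h2
  have hlim := ENNReal.tendsto_ofReal (hreal.comp hfl)
  rw [ENNReal.ofReal_zero] at hlim
  refine tendsto_of_tendsto_of_tendsto_of_le_of_le tendsto_const_nhds hlim (fun _ => bot_le) ?_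
  intro n
  have h1 : q ^ ⌊η * n⌋₊ * (2 * n + 4) = ENNReal.ofReal (r ^ ⌊η * (n : ℝ)⌋₊ * (2 * n + 4)) := by
    rw [ENNReal.ofReal_mul (by positivity), ENNReal.ofReal_pow hr0, hr,
      ENNReal.ofReal_toReal hq.ne_top]
    congr 1
    rw [ENNReal.ofReal_add (by positivity) (by positivity), ENNReal.ofReal_mul two_pos.le]
    simp
  dsimp only
  rw [h1]
  refine ENNReal.ofReal_le_ofReal ?_
  simp only [Function.comp_apply]
  have h2 : (n : ℝ) ≤ (⌊η * (n : ℝ)⌋₊ + 1) / η := by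
    rw [le_div_iff₀ hη, mul_comm]
    exact (Nat.lt_floor_add_one _).le
  calc r ^ ⌊η * (n : ℝ)⌋₊ * (2 * n + 4)
      ≤ r ^ ⌊η * (n : ℝ)⌋₊ * (2 * ((⌊η * (n : ℝ)⌋₊ + 1) / η) + 4) := by gcongr
    _ = _ := by ring

lemma log_card_secrets_le (m : ℕ) :
    Real.log (Fintype.card (Strings m × Bool)) + 1 ≤ 2 * m + 2 := by
  have h : (Fintype.card (Strings m × Bool) : ℝ) = 2 ^ (2 * m + 1) := by
    simp; ring
  rw [h, Real.log_pow]
  have h2 : Real.log 2 ≤ 1 := by linarith [Real.log_two_lt_d9]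
  have : ((2 * m + 1 : ℕ) : ℝ) * Real.log 2 ≤ (2 * m + 1 : ℕ) := mul_le_of_le_one_right (by positivity) h2
  push_cast at this ⊢
  linarith

variable {ε₁ ε₂ : unitInterval}

lemma achievable_of_lt {R : ℝ≥0} (hR0 : 0 < R) (h₁ : (R : ℝ) < ε₁)
    (h₂ : (R : ℝ) < ε₂ * (1 - ε₁) / 3) : Achievable (degradedBEC ε₁ ε₂) R := by
  have hR0' : (0 : ℝ) < R := hR0
  have hε₂ : 0 < (ε₂ : ℝ) := by
    refine ε₂.2.1.lt_of_ne fun h0 => ?_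
    rw [← h0] at h₂
    linarith
  have hR1 : (R : ℝ) < 1 := h₁.trans_le ε₁.2.2
  -- `σ` is the rate of the key block: large enough that Eve misses more than `2 R n` of its bits,
  -- small enough that Bob receives it together with a block of rate `R`. The interval is nonempty
  -- because `R + 2 R / ε₂ ≤ 3 R / ε₂ < 1 - ε₁`.
  obtain ⟨σ, hσ₁, hσ₂⟩ : ∃ σ : ℝ, 2 * (R : ℝ) / (ε₂ : ℝ) < σ ∧ σ < 1 - (ε₁ : ℝ) - R := by
    refine exists_between ?_
    rw [div_lt_iff₀ hε₂]
    nlinarith [ε₂.2.2]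
  have hσ0 : 0 < σ := lt_trans (by positivity) hσ₁
  -- `ρ` is the fraction of the key block that is erased for Eve with high probability.
  obtain ⟨ρ, hρ₁, hρ₂⟩ : ∃ ρ : ℝ, 2 * (R : ℝ) / σ < ρ ∧ ρ < (ε₂ : ℝ) := by
    refine exists_between ?_
    rw [div_lt_iff₀ hε₂] at hσ₁
    rw [div_lt_iff₀ hσ0]
    linarith
  have hρ0 : 0 < ρ := lt_trans (by positivity) hρ₁
  rw [div_lt_iff₀ hσ0] at hρ₁
  -- The three rare events: too few erasures for the bad block, too few received bits for the other
  -- two blocks, too few key bits erased for Eve.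
  obtain ⟨q₁, hq₁, ht₁⟩ := exists_coin_tail ε₁ false (ν := 1 - R) (by simpa using h₁)
  obtain ⟨q₂, hq₂, ht₂⟩ := exists_coin_tail ε₁ true (ν := 1 - R - σ) (by simp; linarith)
  obtain ⟨q₃, hq₃, ht₃⟩ := exists_coin_tail ε₂ false (ν := 1 - ρ) (by simpa using hρ₂)
  -- The added 1 keeps the string length positive for every `n`.
  set m : ℕ → ℕ := fun n => ⌊(R : ℝ) * n⌋₊ + 1 with hm
  set s : ℕ → ℕ := fun n => ⌊σ * n⌋₊ with hs
  have hRn : ∀ n : ℕ, (⌊(R : ℝ) * n⌋₊ : ℝ) ≤ R * n := fun n => Nat.floor_le (by positivity)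
  have hσn : ∀ n : ℕ, (⌊σ * n⌋₊ : ℝ) ≤ σ * n := fun n => Nat.floor_le (by positivity)
  refine ⟨m, fun n => otProtocol n (m n) (s n), fun n => Nat.succ_pos _, ?_, ?_, ?_, ?_, ?_⟩
  · rw [← NNReal.tendsto_coe]
    push_cast
    have h1 : Tendsto (fun n : ℕ => (⌊(R : ℝ) * n⌋₊ : ℝ) / n) atTop (𝓝 R) :=
      (tendsto_nat_floor_mul_div_atTop hR0'.le).comp tendsto_natCast_atTop_atTop
    have h2 : Tendsto (fun n : ℕ => (1 : ℝ) / n) atTop (𝓝 0) := tendsto_one_div_atTop_nhds_zero_nat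
    have h3 := h1.add h2
    rw [add_zero] at h3
    refine h3.congr fun n => ?_
    rw [hm]
    push_cast
    rw [add_div]
  · have hlim := (ENNReal.tendsto_pow_atTop_nhds_zero_of_lt_one hq₁).add
      (ENNReal.tendsto_pow_atTop_nhds_zero_of_lt_one hq₂)
    rw [add_zero] at hlim
    refine tendsto_of_tendsto_of_tendsto_of_le_of_le tendsto_const_nhds hlim (fun _ => bot_le)
      fun n => ?_
    refine (errorProb_otProtocol_le ε₁ ε₂).trans ((toOuterMeasure_aborted_le ε₁ ε₂).trans ?_)
    have hb₁ := ht₁ n n (Function.Embedding.refl _) (n + 1 - m n) (by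
      have : n ≤ (n + 1 - m n) + ⌊(R : ℝ) * n⌋₊ := by simp only [hm]; omega
      have : (n : ℝ) ≤ (n + 1 - m n : ℕ) + ⌊(R : ℝ) * n⌋₊ := by exact_mod_cast this
      linarith [hRn n])
    have hb₂ := ht₂ n n (Function.Embedding.refl _) (n + 1 - (m n + s n)) (by
      have : n ≤ (n + 1 - (m n + s n)) + ⌊(R : ℝ) * n⌋₊ + ⌊σ * n⌋₊ := by
        simp only [hm, hs]; omega
      have : (n : ℝ) ≤ (n + 1 - (m n + s n) : ℕ) + ⌊(R : ℝ) * n⌋₊ + ⌊σ * n⌋₊ := by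
        exact_mod_cast this
      linarith [hRn n, hσn n])
    exact add_le_add hb₁ hb₂
  · simp only [leakToBob_otProtocol]
    exact tendsto_const_nhds
  · simp only [leakToAlice_otProtocol]
    exact tendsto_const_nhds
  · set η := σ * ρ - 2 * R with hη
    have hη0 : 0 < η := by rw [hη]; linarith
    have hlim := (tendsto_linear_mul_pow_floor hq₃ hσ0).add
      (ENNReal.Tendsto.const_mul (a := 16) (tendsto_linear_mul_pow_floor (q := 2⁻¹) (by simp) hη0)
        (Or.inr (by simp)))
    rw [mul_zero, add_zero] at hlim
    refine tendsto_of_tendsto_of_tendsto_of_le_of_le tendsto_const_nhds hlim (fun _ => bot_le)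
      fun n => ?_
    set N := ⌈(1 - ρ) * (s n : ℝ)⌉₊ with hN
    have hbad := toOuterMeasure_insecure_le (n := n) (m := m n) (s := s n) ε₁ ε₂ N (q₃ ^ s n)
      fun ι => ht₃ n (s n) ι N (Nat.le_ceil _)
    refine (leakToEve_otProtocol_le ε₁ ε₂).trans ?_
    have hfac : ENNReal.ofReal (Real.log (Fintype.card (Strings (m n) × Bool)) + 1) ≤ 2 * n + 4 := by
      refine (ENNReal.ofReal_le_ofReal (q := 2 * n + 4) ?_).trans (le_of_eq ?_)
      · refine (log_card_secrets_le _).trans ?_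
        have : (R : ℝ) * n ≤ n := mul_le_of_le_one_left (by positivity) hR1.le
        simp only [hm]
        push_cast
        linarith [hRn n]
      · rw [ENNReal.ofReal_add (by positivity) (by positivity), ENNReal.ofReal_mul two_pos.le]
        simp
    -- The 4 absorbs all rounding: the left side is at most `σ ρ n + 3`, while `s n + 1 - N ≥ ρ (σ n
    -- - 1)` and `ρ < 1`. It becomes the factor `16 = 2 ^ 4` below.
    have hexp : 2 * m n + 1 + ⌊η * n⌋₊ ≤ s n + 1 - N + 4 := by
      have h1 : (N : ℝ) ≤ (1 - ρ) * s n + 1 :=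
        (Nat.ceil_lt_add_one (mul_nonneg (by linarith [ε₂.2.2]) (by positivity))).le
      have h2 : σ * n - 1 ≤ s n := (Nat.sub_one_lt_floor _).le
      have h3 : (⌊η * n⌋₊ : ℝ) ≤ η * n := Nat.floor_le (by positivity)
      have h4 : (s n : ℝ) + 1 ≤ (s n + 1 - N : ℕ) + N := by
        have : s n + 1 ≤ (s n + 1 - N) + N := by omega
        exact_mod_cast this
      have h5 : (m n : ℝ) = ⌊(R : ℝ) * n⌋₊ + 1 := by simp [hm]
      have h6 : ρ * (σ * n - 1) ≤ ρ * s n := by gcongr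
      have h7 : ((2 * m n + 1 + ⌊η * n⌋₊ : ℕ) : ℝ) ≤ (s n + 1 - N : ℕ) + 4 := by
        push_cast
        rw [h5]
        have h8 := hRn n
        have h9 := ε₂.2.2
        rw [hη] at h3 ⊢
        nlinarith
      exact_mod_cast h7
    have hpow : (2 : ℝ≥0∞) ^ (2 * m n + 1) * 2⁻¹ ^ (s n + 1 - N) ≤ 16 * 2⁻¹ ^ ⌊η * n⌋₊ := by
      have hinv : ∀ k : ℕ, (2 : ℝ≥0∞) ^ k * 2⁻¹ ^ k = 1 := fun k => by
        rw [← mul_pow, ENNReal.mul_inv_cancel (by simp) (by simp), one_pow]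
      calc (2 : ℝ≥0∞) ^ (2 * m n + 1) * 2⁻¹ ^ (s n + 1 - N)
          = 2 ^ (2 * m n + 1) * (2 ^ 4 * 2⁻¹ ^ (s n + 1 - N + 4)) := by
            rw [pow_add 2⁻¹ (s n + 1 - N), mul_left_comm (2 ^ 4), hinv, mul_one]
        _ ≤ 2 ^ (2 * m n + 1) * (2 ^ 4 * 2⁻¹ ^ (2 * m n + 1 + ⌊η * n⌋₊)) := by
            refine mul_le_mul_right (mul_le_mul_right ?_ _) _
            exact pow_le_pow_right_of_le_one' (by simp) hexp
        _ = 16 * (2 ^ (2 * m n + 1) * 2⁻¹ ^ (2 * m n + 1)) * 2⁻¹ ^ ⌊η * n⌋₊ := by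
            rw [pow_add 2⁻¹ (2 * m n + 1)]
            ring
        _ = _ := by rw [hinv, mul_one]
    calc _ ≤ (q₃ ^ s n + 16 * 2⁻¹ ^ ⌊η * n⌋₊) * (2 * n + 4) := by
          refine mul_le_mul' (hbad.trans ?_) hfac
          gcongr
      _ = _ := by rw [add_mul, mul_assoc]

/-- The lower bound on the oblivious transfer capacity. -/
lemma le_otCapacity_degradedBEC (ε₁ ε₂ : unitInterval) :
    ENNReal.ofReal (min ((ε₂ : ℝ) * (1 - ε₁) / 3) ε₁) ≤ otCapacity (degradedBEC ε₁ ε₂) := by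
  refine le_of_forall_lt fun c hc => ?_
  -- A rate strictly between `c` and the bound is positive and satisfies both strict inequalities
  -- required for achievability.
  obtain ⟨R, hcR, hR⟩ := ENNReal.lt_iff_exists_nnreal_btwn.1 hc
  refine hcR.trans_le (le_iSup₂_of_le R (achievable_of_lt ?_ ?_ ?_) le_rfl)
  · exact ENNReal.coe_pos.1 (pos_of_gt hcR)
  all_goals
    rw [← ENNReal.ofReal_coe_nnreal, ENNReal.ofReal_lt_ofReal_iff_of_nonneg R.coe_nonneg, lt_min_iff] at hR
  · exact hR.2
  · exact hR.1

end Achievability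

end WiretapOT

end

theorem theorem1 (ε₁ ε₂ : unitInterval) :
    ENNReal.ofReal (min ((ε₂ : ℝ) * (1 - (ε₁ : ℝ)) / 3) (ε₁ : ℝ))
        ≤ WiretapOT.otCapacity (WiretapOT.degradedBEC ε₁ ε₂) ∧
    WiretapOT.otCapacity (WiretapOT.degradedBEC ε₁ ε₂)
        ≤ ENNReal.ofReal (min ((ε₂ : ℝ) * (1 - (ε₁ : ℝ))) (ε₁ : ℝ)) ∧
    ((ε₁ : ℝ) ≤ (ε₂ : ℝ) * (1 - (ε₁ : ℝ)) / 3 →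
      WiretapOT.otCapacity (WiretapOT.degradedBEC ε₁ ε₂) = ENNReal.ofReal (ε₁ : ℝ)) := by
  refine ⟨WiretapOT.le_otCapacity_degradedBEC ε₁ ε₂, WiretapOT.otCapacity_degradedBEC_le ε₁ ε₂,
    fun h => le_antisymm ?_ ?_⟩
  · exact (WiretapOT.otCapacity_degradedBEC_le ε₁ ε₂).trans
      (ENNReal.ofReal_le_ofReal (min_le_right _ _))
  · have h1 := WiretapOT.le_otCapacity_degradedBEC ε₁ ε₂
    rwa [min_eq_right h] at h1
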